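/- Let $\mathcal S$ be a commutative semigroup, written additively. Let $\mathcal S^0=\mathcal S$ if $\mathcal S$ has an identity element $0$, let $\mathcal S^0=\mathcal S\cup\{0\}$ with a new identity $0$ otherwise, and put $\mathcal S^\bullet=\mathcal S^0\setminus\{0\}$. A sequence $T$ over $\mathcal S$ is a finite multiset of elements of $\mathcal S$; $|T|$ is its length and $\sigma(T)\in\mathcal S^0$ the sum of its terms, with $\sigma(\emptyset)=0$. $T$ is irreducible if no proper subsequence $T'$ of $T$ (the empty one included) has $\sigma(T')=\sigma(T)$. For $a\in\mathcal S^\bullet$ let - $\mathrm D_a(\mathcal S)\in\mathbb N\cup\{\infty\}$ be the largest length of an irreducible sequence $T$ over $\mathcal S$ with $\sigma(T)=a$; - $(a)=\{a+c: c\in\mathcal S^0\}$, let $a\,\mathcal H\,b$ mean $(a)=(b)$, and let $H_a$ be the $\mathcal H$-class of $a$; - $\Psi(a)\in\mathbb N_0\cup\{\infty\}$ be the largest $\ell$ for which there are $a_1,\dots,a_\ell\in\mathcal S^0$ with $(a)\subsetneq(a_1)\subsetneq\cdots\subsetneq(a_\ell)$; - $\Gamma(H_a)$ be the Schützenberger group,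 that is, the abelian group (under composition) of all maps $\gamma_c:H_a\to H_a$, $x\mapsto c+x$, where $c\in\mathcal S^0$ satisfies $c+H_a\subseteq H_a$; - $\epsilon=\frac12$ if $(a+a)\,\mathcal H\,a$, and $\epsilon=1$ otherwise. For an abelian group $G$ let $\mathrm D(G)$ be the Davenport constant: the smallest $\ell\in\mathbb N\cup\{\infty\}$ such that every sequence over $G$ of length at least $\ell$ has a nonempty subsequence with sum $0$. **Theorem.** Let $\mathcal S$ be a commutative semigroup and $a\in\mathcal S^\bullet$ with $\Psi(a)$ finite. If $H_a$ is infinite, then $\mathrm D_a(\mathcal S)$ is infinite. If $H_a$ is finite, then $\mathrm D_a(\mathcal S)$ is finite and $$\epsilon\,\mathrm D(\Gamma(H_a))\le \mathrm D_a(\mathcal S)\le \Psi(a)+\mathrm D(\Gamma(H_a))-1 .$$ Both bounds are sharp, as the following cases show; in each of them $a\in\mathcal S^\bullet$, $\Psi(a)$ is finite and $H_a$ is finite. 1. Let $n\ge 2$ be even, $1\le k\le r$, let $\mathcal S$ be the commutative semigroup with generators $x_1,\dots,x_r$ and relations $(n+1)x_i=x_i$ for all $i$ and $x_i+x_j=x_j$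 for $i<j$, and let $a=\frac n2x_k$. Then $(a+a)\,\mathcal H\,a$, $\mathrm D(\Gamma(H_a))=n$ and $\mathrm D_a(\mathcal S)=\frac12\mathrm D(\Gamma(H_a))$. 2. Let $m>2$, let $\mathcal S$ be the commutative semigroup with a zero element $\infty$ generated by $x_0,x_1,\dots,x_m$ with the relations $(m+1)x_0=x_0$, $x_i+x_j=\infty$ for $i,j\in[1,m]$, $x_0+x_k=x_{k+1}$ for $k\in[1,m-1]$ and $x_0+x_m=x_1$, and let $a=x_m$. Then $(a+a)\,\mathcal H\,a$ does not hold, $\mathrm D(\Gamma(H_a))=m$ and $\mathrm D_a(\mathcal S)=\mathrm D(\Gamma(H_a))$. 3. Let $R$ be a finite commutative principal ideal ring with $1$, let $\mathcal S$ be its multiplicative semigroup and $a\in R$ a non-unit. Then $\mathrm D_a(\mathcal S)=\Psi(a)+\mathrm D(\Gamma(H_a))-1$. -/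

import Mathlib

open scoped ENNReal

namespace RelDavenport

/-! ### The monoid `S⁰` obtained by adjoining an identity only when necessary -/

section AdjoinZero

variable (S : Type*) [AddCommSemigroup S]

/-- The congruence on `S ∪ {0}` (a new identity `0` is always adjoined first) which identifies the
new `0` with the identity element of `S` if there is one, and identifies nothing else. -/
def zeroCon : AddCon (WithZero S) where
  r x y := x = y ∨ ((∀ s : S, x + (s : WithZero S) = s) ∧ (∀ s : S, y + (s : WithZero S) = s))
  iseqv :=
    { refl := fun _ => Or.inl rfl
      symm := by
        rintro x y (h | ⟨h₁, h₂⟩)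
        · exact Or.inl h.symm
        · exact Or.inr ⟨h₂, h₁⟩
      trans := by
        rintro x y z (h | ⟨h₁, h₂⟩) (k | ⟨k₁, k₂⟩)
        · exact Or.inl (h.trans k)
        · subst h; exact Or.inr ⟨k₁, k₂⟩
        · subst k; exact Or.inr ⟨h₁, h₂⟩
        · exact Or.inr ⟨h₁, k₂⟩ }
  add' := by
    have key : ∀ x y z : WithZero S, (∀ s : S, x + (s : WithZero S) = s) →
        (∀ s : S, y + (s : WithZero S) = s) →
        (x + z = y + z ∨
          ((∀ s : S, x + z + (s : WithZero S) = s) ∧ (∀ s : S, y + z + (s : WithZero S) = s))) := by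
      intro x y z hx hy
      induction z with
      | zero => right; simpa using ⟨hx, hy⟩
      | coe t => left; rw [hx, hy]
    rintro w x y z (h | ⟨h₁, h₂⟩) (k | ⟨k₁, k₂⟩)
    · left; rw [h, k]
    · subst h
      rw [add_comm w y, add_comm w z]
      exact key y z w k₁ k₂
    · subst k
      exact key w x y h₁ h₂
    · right
      constructor
      · intro s; rw [add_assoc, k₁, h₁]
      · intro s; rw [add_assoc, k₂, h₂]

/-- `S⁰`: the semigroup `S` itself if it has an identity element, and `S ∪ {0}` otherwise. -/
abbrev AdjoinZero : Type _ := (zeroCon S).Quotient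

end AdjoinZero

section Sequences

variable {S : Type*} [AddCommSemigroup S]

/-- The inclusion of `S` in `S⁰`. -/
def incl (s : S) : AdjoinZero S := ((s : WithZero S) : (zeroCon S).Quotient)

theorem incl_add (s t : S) : incl (s + t) = incl s + incl t := rfl

theorem incl_injective : Function.Injective (incl (S := S)) := by
  intro s t h
  rcases (zeroCon S).eq.1 h with h | ⟨h₁, h₂⟩
  · exact WithZero.coe_inj.1 h
  · have e₁ : s + t = t := WithZero.coe_inj.1 (h₁ t)
    have e₂ : t + s = s := WithZero.coe_inj.1 (h₂ s)
    rw [← e₂, add_comm, e₁]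

theorem incl_eq_zero_iff (e : S) : incl e = 0 ↔ ∀ s : S, e + s = s := by
  constructor
  · intro h s
    apply incl_injective
    rw [incl_add, h, zero_add]
  · intro h
    refine (zeroCon S).eq.2 (Or.inr ⟨fun s => ?_, fun s => zero_add _⟩)
    exact WithZero.coe_inj.2 (h s)

theorem eq_zero_or_incl (x : AdjoinZero S) : x = 0 ∨ ∃ s : S, x = incl s := by
  induction x using AddCon.induction_on with
  | H x =>
    induction x with
    | zero => exact Or.inl rfl
    | coe s => exact Or.inr ⟨s, rfl⟩

/-- Sequences over `S` are multisets; `σ(T)` is the sum of all terms, and the empty sequence has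
sum `0`. -/
def seqSum (T : Multiset S) : AdjoinZero S := (T.map incl).sum

/-- A sequence is reducible if some proper subsequence has the same sum. -/
def Reducible (T : Multiset S) : Prop := ∃ T' : Multiset S, T' < T ∧ seqSum T' = seqSum T

/-- `D_a(S)`: the largest length, in `ℕ ∪ {∞}`, of an irreducible sequence over `S` with sum `a`. -/
noncomputable def relDavenport (a : AdjoinZero S) : ℕ∞ :=
  ⨆ (T : Multiset S) (_ : ¬ Reducible T ∧ seqSum T = a), (T.card : ℕ∞)

end Sequences

/-- `D(G)` for an abelian group `G`: the smallest `ℓ ∈ ℕ ∪ {∞}` such that every sequence over `G`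
of length at least `ℓ` has a nonempty zero-sum subsequence. -/
noncomputable def davenport (G : Type*) [AddCommGroup G] : ℕ∞ :=
  sInf {l : ℕ∞ | ∀ T : Multiset G, l ≤ (T.card : ℕ∞) → ∃ T' ≤ T, T' ≠ 0 ∧ T'.sum = 0}

/-! ### Green's relation, chains of principal ideals and the Schützenberger group

These are stated for a commutative monoid and will be used for the monoid `S⁰`. If `S` has no
identity then `0` is alone in its class, so that for `a ∈ S` the class of `a` in `S⁰` is
its class in `S`. -/

section Green

variable {M : Type*} [AddCommMonoid M]

/-- The principal ideal `(a) = {a + c}`. -/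
def principalIdeal (a : M) : Set M := {x | ∃ c : M, x = a + c}

/-- Green's relation: `a` and `b` generate the same principal ideal. -/
def GreenH (a b : M) : Prop := principalIdeal a = principalIdeal b

/-- The class `H_a`. -/
def hClass (a : M) : Set M := {x | GreenH x a}

/-- `Ψ(a)`: the largest `ℓ ∈ ℕ ∪ {∞}` with a chain `(a) ⊊ (a₁) ⊊ ⋯ ⊊ (a_ℓ)`. -/
noncomputable def chainLength (a : M) : ℕ∞ :=
  ⨆ (l : ℕ) (_ : ∃ f : Fin (l + 1) → M, f 0 = a ∧
      ∀ i : Fin l, principalIdeal (f i.castSucc) ⊂ principalIdeal (f i.succ)), (l : ℕ∞)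

open Classical in
/-- `ε = 1/2` if `a + a` and `a` are `𝓗`-related, and `ε = 1` otherwise. -/
noncomputable def epsilon (a : M) : ℝ≥0∞ := if GreenH (a + a) a then 1 / 2 else 1

/-- The stabilizer `St(A)`. -/
def stabilizer (A : Set M) : Set M := {c | ∀ x ∈ A, c + x ∈ A}

/-- The map `γ_c : H_a → H_a`, `x ↦ c + x`, for `c ∈ St(H_a)`. -/
def gammaMap (a : M) (c : stabilizer (hClass a)) (x : hClass a) : hClass a :=
  ⟨c + x, c.2 x x.2⟩

/-- The Schützenberger group `Γ(H_a) = {γ_c : c ∈ St(H_a)}`, a set of maps `H_a → H_a`. -/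
def Schutzenberger (a : M) : Type _ :=
  {f : hClass a → hClass a // ∃ c : stabilizer (hClass a), f = gammaMap a c}

theorem mem_hClass_iff {a x : M} : x ∈ hClass a ↔ (∃ c, a = x + c) ∧ ∃ c, x = a + c := by
  constructor
  · intro h
    have h' : principalIdeal x = principalIdeal a := h
    constructor
    · have : a ∈ principalIdeal a := ⟨0, by simp⟩
      rwa [← h'] at this
    · have : x ∈ principalIdeal x := ⟨0, by simp⟩
      rwa [h'] at this
  · rintro ⟨⟨c, hc⟩, d, hd⟩
    apply Set.Subset.antisymm
    · rintro _ ⟨e, rfl⟩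
      exact ⟨d + e, by rw [← add_assoc, ← hd]⟩
    · rintro _ ⟨e, rfl⟩
      exact ⟨c + e, by rw [← add_assoc, ← hc]⟩

/-- An element that fixes `a` fixes every element of `H_a`. -/
theorem fix_hClass {a e : M} (h : e + a = a) {x : M} (hx : x ∈ hClass a) : e + x = x := by
  obtain ⟨-, c, rfl⟩ := mem_hClass_iff.1 hx
  rw [← add_assoc, h]

theorem mem_stabilizer_of_add_mem {a c : M} (h : c + a ∈ hClass a) :
    c ∈ stabilizer (hClass a) := by
  intro x hx
  obtain ⟨⟨d, hd⟩, -⟩ := mem_hClass_iff.1 h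
  have h1 := mem_hClass_iff.1 hx
  obtain ⟨⟨p, hp⟩, q, hq⟩ := h1
  obtain ⟨-, r, hr⟩ := mem_hClass_iff.1 h
  refine mem_hClass_iff.2 ⟨⟨p + d, ?_⟩, r + q, ?_⟩
  · calc a = c + a + d := hd
      _ = c + (x + p) + d := by rw [← hp]
      _ = c + x + (p + d) := by abel
  · calc c + x = c + (a + q) := by rw [← hq]
      _ = (c + a) + q := by abel
      _ = a + r + q := by rw [← hr]
      _ = a + (r + q) := by abel

theorem exists_neg_stabilizer (a : M) (c : stabilizer (hClass a)) :
    ∃ d : stabilizer (hClass a), ∀ x ∈ hClass a, (d : M) + (c + x) = x := by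
  have ha : a ∈ hClass a := rfl
  obtain ⟨⟨d, hd⟩, -⟩ := mem_hClass_iff.1 (c.2 a ha)
  have hda : d + (c : M) + a = a := by
    conv_rhs => rw [hd]
    abel
  have hds : d ∈ stabilizer (hClass a) := by
    apply mem_stabilizer_of_add_mem
    refine mem_hClass_iff.2 ⟨⟨c, ?_⟩, d, add_comm _ _⟩
    conv_lhs => rw [hd]
    abel
  refine ⟨⟨d, hds⟩, fun x hx => ?_⟩
  rw [← add_assoc]
  exact fix_hClass hda hx

theorem exists_neg_schutzenberger (a : M) (f : Schutzenberger a) :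
    ∃ g : Schutzenberger a, g.1 ∘ f.1 = id := by
  obtain ⟨f, c, rfl⟩ := f
  obtain ⟨d, hd⟩ := exists_neg_stabilizer a c
  exact ⟨⟨gammaMap a d, d, rfl⟩, funext fun x => Subtype.ext (hd x x.2)⟩

/-- The group operation of `Γ(H_a)` is composition of maps, that is `γ_c + γ_d = γ_{c + d}`. -/
instance (a : M) : Add (Schutzenberger a) where
  add f g := ⟨f.1 ∘ g.1, by
    obtain ⟨f, c, rfl⟩ := f
    obtain ⟨g, d, rfl⟩ := g
    refine ⟨⟨c + d, fun x hx => ?_⟩, funext fun x => Subtype.ext (add_assoc _ _ _).symm⟩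
    rw [add_assoc]
    exact c.2 _ (d.2 x hx)⟩

instance (a : M) : Zero (Schutzenberger a) where
  zero := ⟨id, ⟨0, fun x hx => by simpa using hx⟩, funext fun x => Subtype.ext (zero_add _).symm⟩

noncomputable instance (a : M) : Neg (Schutzenberger a) where
  neg f := (exists_neg_schutzenberger a f).choose

noncomputable instance (a : M) : AddCommGroup (Schutzenberger a) where
  add_assoc _ _ _ := rfl
  zero_add _ := rfl
  add_zero _ := rfl
  neg_add_cancel f := Subtype.ext (exists_neg_schutzenberger a f).choose_spec
  add_comm := by
    rintro ⟨f, c, rfl⟩ ⟨g, d, rfl⟩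
    exact Subtype.ext (funext fun x => Subtype.ext (add_left_comm _ _ _))
  nsmul := nsmulRec
  zsmul := zsmulRec

end Green

/-! ### Commutative semigroups given by generators and relations -/

section Presented

/-- The free commutative semigroup on `X`: nonempty multisets. -/
def FreeCommSemigroup (X : Type*) : Type _ := {m : Multiset X // m ≠ 0}

instance (X : Type*) : AddCommSemigroup (FreeCommSemigroup X) where
  add u v := ⟨u.1 + v.1, fun h => u.2 (by simpa using (add_eq_zero.1 h).1)⟩
  add_assoc u v w := Subtype.ext (add_assoc u.1 v.1 w.1)
  add_comm u v := Subtype.ext (add_comm u.1 v.1)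

/-- The commutative semigroup `⟨X | r⟩`; a word in the generators is a nonempty multiset. -/
abbrev Presented {X : Type*} (r : Multiset X → Multiset X → Prop) : Type _ :=
  (addConGen (fun u v : FreeCommSemigroup X => r u.1 v.1)).Quotient

/-- The class of a generator. -/
def gen {X : Type*} (r : Multiset X → Multiset X → Prop) (x : X) : Presented r :=
  AddCon.toQuotient (c := addConGen (fun u v : FreeCommSemigroup X => r u.1 v.1))
    ⟨{x}, by simp⟩

/-- The relations `(n + 1) x_i = x_i`, and `x_i + x_j = x_j` for `i < j`. -/
inductive ChainRel (n r : ℕ) : Multiset (Fin r) → Multiset (Fin r) → Prop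
  | period (i : Fin r) : ChainRel n r ((n + 1) • {i}) {i}
  | absorb (i j : Fin r) (h : i < j) : ChainRel n r ({i} + {j}) {j}

/-- The generators `x_0`, `x_k` with `k` modulo `m`, and `∞`. -/
inductive TorsorGen (m : ℕ) : Type
  | base : TorsorGen m
  | point (k : ZMod m) : TorsorGen m
  | infty : TorsorGen m

/-- The relations `(m + 1) x_0 = x_0`, `x_i + x_j = ∞` and `x_0 + x_k = x_{k + 1}` for indices
modulo `m`, together with those that make `∞` a zero element. -/
inductive TorsorRel (m : ℕ) : Multiset (TorsorGen m) → Multiset (TorsorGen m) → Prop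
  | period : TorsorRel m ((m + 1) • {.base}) {.base}
  | shift (k : ZMod m) : TorsorRel m ({.base} + {.point k}) {.point (k + 1)}
  | collapse (i j : ZMod m) : TorsorRel m ({.point i} + {.point j}) {.infty}
  | infty (y : TorsorGen m) : TorsorRel m ({.infty} + {y}) {.infty}

end Presented

end RelDavenport

open RelDavenport

/-!
Upper bound: let `T` be irreducible with sum `a`, and let `A` be a minimal subsequence whose sum
lies in `H_a`. Adding the terms of `A` one by one gives a strictly descending chain of principal
ideals, so `|A| ≤ Ψ(a)`; the remaining terms stabilize `H_a`, and irreducibility of `T` makes their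
images in `Γ(H_a)` a zero-sum free sequence.

Lower bound: if `a + a` is not in `H_a`, lift a zero-sum free sequence over `Γ(H_a)` to the
stabilizer and add one more term, a translate of `a` correcting the sum; no subsequence without this
term has sum `a`, since `a` does not stabilize `H_a`. Otherwise `H_a` contains an idempotent and is
itself a group isomorphic to `Γ(H_a)`. Let `T` be a zero-sum free sequence over this group. If no
subsequence of `T` has sum `a`, then appending `a - σ(T)` gives an irreducible sequence with sum
`a`. If `A` is a subsequence with sum `a`, then `a` is also the sum of the negated complement of `A`
in the minimal zero-sum sequence obtained by appending `-σ(T)` to `T`, and one of the two contains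
at least half of the `|T| + 1` terms.

The upper bound is attained when the one term `a` can be replaced by a sequence of length `Ψ(a)`
no proper subsequence of which has, up to the lifts of `Γ(H_a)`, the sum `a`. Over a principal ideal
ring a shortest factorization of `a` into generators of maximal ideals is such a sequence, since
`Γ(H_a)` lifts to units.
-/

namespace RelDavenport

section Multisets

variable {α β : Type*}

theorem le_cons_cases {g : α} {T' T : Multiset α} (h : T' ≤ g ::ₘ T) :
    T' ≤ T ∨ ∃ U ≤ T, T' = g ::ₘ U := by
  simpa only [← Multiset.mem_powerset, Multiset.powerset_cons, Multiset.mem_add,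
    Multiset.mem_map, eq_comm (a := T')] using h

theorem exists_eq_add_of_le_add {T A B : Multiset α} (h : T ≤ A + B) :
    ∃ A' ≤ A, ∃ B' ≤ B, T = A' + B' := by
  classical
  refine ⟨T ∩ A, Multiset.inter_le_right, T - A, tsub_le_iff_left.2 h, ?_⟩
  rw [add_comm, Multiset.sub_add_inter]

theorem exists_map_eq_of_le_map {f : α → β} {T : Multiset α} {T' : Multiset β}
    (h : T' ≤ T.map f) : ∃ U ≤ T, U.map f = T' := by
  induction T using Multiset.induction generalizing T' with
  | empty => exact ⟨0, le_rfl, (nonpos_iff_eq_zero.1 h).symm⟩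
  | cons x T ih =>
    rw [Multiset.map_cons] at h
    rcases le_cons_cases h with h | ⟨V, hV, rfl⟩
    · obtain ⟨U, hU, rfl⟩ := ih h
      exact ⟨U, hU.trans (Multiset.le_cons_self _ _), rfl⟩
    · obtain ⟨U, hU, rfl⟩ := ih hV
      exact ⟨x ::ₘ U, Multiset.cons_le_cons x hU, Multiset.map_cons _ _ _⟩

theorem exists_map_eq_of_lt_map {f : α → β} {T : Multiset α} {T' : Multiset β}
    (h : T' < T.map f) : ∃ U < T, U.map f = T' := by
  obtain ⟨U, hU, rfl⟩ := exists_map_eq_of_le_map h.le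
  exact ⟨U, hU.lt_of_ne (by rintro rfl; exact h.false), rfl⟩

end Multisets

/-! ### Irreducible and zero-sum free sequences -/

section Irreducible

variable {M N : Type*} [AddCommMonoid M] [AddCommMonoid N] {T : Multiset M}

/-- A sequence over a monoid is irreducible if no proper subsequence, the empty one included, has
the same sum. This is the notion for sequences over `S` (`Reducible`) carried over to `S⁰`. -/
def IrreducibleSeq (T : Multiset M) : Prop := ∀ T' < T, T'.sum ≠ T.sum

theorem IrreducibleSeq.zero_notMem (hT : IrreducibleSeq T) : (0 : M) ∉ T := by
  intro h
  obtain ⟨U, rfl⟩ := Multiset.exists_cons_of_mem h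
  exact hT U (Multiset.lt_cons_self _ _) (by rw [Multiset.sum_cons, zero_add])

theorem IrreducibleSeq.map (hT : IrreducibleSeq T) (f : M →+ N)
    (hf : ∀ x, f x = f T.sum → x = T.sum) : IrreducibleSeq (T.map f) := by
  intro T' hlt
  obtain ⟨U, hU, rfl⟩ := exists_map_eq_of_lt_map hlt
  rw [← map_multiset_sum, ← map_multiset_sum]
  exact fun h => hT U hU (hf _ h)

theorem IrreducibleSeq.of_map {f : M →+ N} (hT : IrreducibleSeq (T.map f)) : IrreducibleSeq T := by
  intro U hU h
  refine hT _ (Multiset.map_strictMono _ hU) ?_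
  rw [← map_multiset_sum, ← map_multiset_sum, h]

/-- A minimal representation of `x` is a nonempty sequence with sum `x` no proper nonempty
subsequence of which has sum `x`. For `x = 0` these are the minimal zero-sum sequences, which are
not irreducible. -/
def IsMinimalRep (x : M) (U : Multiset M) : Prop :=
  U ≠ 0 ∧ U.sum = x ∧ ∀ U' < U, U' ≠ 0 → U'.sum ≠ x

/-- Since `θ` need not preserve `0`, this turns a minimal zero-sum sequence into an irreducible
sequence when `x = 0`. -/
theorem IsMinimalRep.irreducibleSeq_map {x : M} {U : Multiset M} (hU : IsMinimalRep x U)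
    {θ : M →ₙ+ N} (hinj : Function.Injective θ) (hx : θ x ≠ 0) :
    IrreducibleSeq (U.map θ) ∧ (U.map θ).sum = θ x := by
  obtain ⟨hne, hsum, hmin⟩ := hU
  have hθ : (U.map θ).sum = θ x := by rw [← map_multiset_ne_zero_sum θ hne, hsum]
  refine ⟨fun T' hlt => ?_, hθ⟩
  obtain ⟨V, hV, rfl⟩ := exists_map_eq_of_lt_map hlt
  rw [hθ]
  rcases eq_or_ne V 0 with rfl | hV0
  · exact hx.symm
  · rw [← map_multiset_ne_zero_sum θ hV0]
    exact hinj.ne (hmin V hV hV0)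

end Irreducible

section ZeroSumFree

variable {G : Type*} [AddCommGroup G] {T : Multiset G}

/-- A sequence over an abelian group is zero-sum free if no nonempty subsequence has sum `0`. -/
def ZeroSumFree (T : Multiset G) : Prop := ∀ T' ≤ T, T' ≠ 0 → T'.sum ≠ 0

theorem ZeroSumFree.mono {U : Multiset G} (hT : ZeroSumFree T) (h : U ≤ T) : ZeroSumFree U :=
  fun T' hT' => hT T' (hT'.trans h)

theorem ZeroSumFree.irreducibleSeq (hT : ZeroSumFree T) : IrreducibleSeq T := by
  intro U hU h
  obtain ⟨V, rfl⟩ := Multiset.le_iff_exists_add.1 hU.le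
  rw [Multiset.sum_add, left_eq_add] at h
  exact hT V (Multiset.le_add_left _ _) (by rintro rfl; simp at hU) h

theorem zeroSumFree_zero : ZeroSumFree (0 : Multiset G) :=
  fun _ hle hne => absurd (nonpos_iff_eq_zero.1 hle) hne

theorem ZeroSumFree.cons {g : G} (hT : ZeroSumFree T) (hg : ∀ U ≤ T, g + U.sum ≠ 0) :
    ZeroSumFree (g ::ₘ T) := by
  intro T' hle hne
  rcases le_cons_cases hle with h | ⟨U, hU, rfl⟩
  · exact hT T' h hne
  · rw [Multiset.sum_cons]
    exact hg U hU

theorem ZeroSumFree.card_lt_natCard [Finite G] (hT : ZeroSumFree T) : T.card < Nat.card G := by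
  induction T using Quotient.inductionOn with
  | h l =>
    have hne : ∀ i j : Fin (l.length + 1), i < j → (l.take i).sum ≠ (l.take j).sum := by
      intro i j hij
      have hlt : (l.take i : Multiset G) < (l.take j : Multiset G) := by
        refine lt_of_le_of_ne (List.take_sublist_take_left hij.le).subperm fun h => ?_
        have := congrArg Multiset.card h
        simp only [Multiset.coe_card, List.length_take] at this
        lia
      exact (hT.mono (List.take_sublist _ l).subperm).irreducibleSeq _ hlt
    have hinj : Function.Injective fun i : Fin (l.length + 1) => (l.take i).sum :=
      .of_lt_imp_ne hne
    simpa [Nat.succ_le_iff] using Nat.card_le_card_of_injective _ hinj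

theorem zeroSumFree_replicate {g : G} {n : ℕ} (h : n < addOrderOf g) :
    ZeroSumFree (Multiset.replicate n g) := by
  intro T' hle hne hsum
  obtain ⟨j, hj, rfl⟩ := Multiset.le_replicate_iff.1 hle
  rw [Multiset.sum_replicate] at hsum
  refine nsmul_ne_zero_of_lt_addOrderOf ?_ (hj.trans_lt h) hsum
  rintro rfl
  exact hne rfl

theorem exists_zeroSumFree_of_infinite (G : Type*) [AddCommGroup G] [Infinite G] (n : ℕ) :
    ∃ T : Multiset G, ZeroSumFree T ∧ T.card = n := by
  classical
  induction n with
  | zero => exact ⟨0, zeroSumFree_zero, rfl⟩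
  | succ n ih =>
    obtain ⟨T, hT, hcard⟩ := ih
    obtain ⟨g, hg⟩ := Infinite.exists_notMem_finset
      ((T.powerset.map fun U => -U.sum).toFinset)
    refine ⟨g ::ₘ T, hT.cons fun U hU h => hg ?_, by rw [Multiset.card_cons, hcard]⟩
    simp only [Multiset.mem_toFinset, Multiset.mem_map, Multiset.mem_powerset]
    exact ⟨U, hU, (eq_neg_of_add_eq_zero_left h).symm⟩

theorem ZeroSumFree.isMinimalRep (hT : ZeroSumFree T) (h0 : T ≠ 0) : IsMinimalRep T.sum T :=
  ⟨h0, rfl, fun U hU _ => hT.irreducibleSeq U hU⟩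

theorem ZeroSumFree.isMinimalRep_zero_cons (hT : ZeroSumFree T) :
    IsMinimalRep 0 (-T.sum ::ₘ T) := by
  refine ⟨Multiset.cons_ne_zero, by rw [Multiset.sum_cons, neg_add_cancel], fun U hU hne h => ?_⟩
  rcases le_cons_cases hU.le with hle | ⟨W, -, rfl⟩
  · exact hT U hle hne h
  · rw [Multiset.sum_cons, neg_add_eq_zero] at h
    exact hT.irreducibleSeq W (Multiset.cons_lt_cons_iff.1 hU) h.symm

theorem IsMinimalRep.map_neg {A C : Multiset G} (h : IsMinimalRep 0 (A + C)) (hC : C ≠ 0) :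
    IsMinimalRep A.sum (C.map Neg.neg) := by
  obtain ⟨-, hsum, hmin⟩ := h
  rw [Multiset.sum_add] at hsum
  have hneg : ∀ V : Multiset G, (V.map Neg.neg).sum = -V.sum := fun V => by
    rw [Multiset.sum_map_neg, Multiset.map_id']
  refine ⟨by simpa using hC, by rw [hneg, eq_neg_of_add_eq_zero_left hsum], fun U' hlt hne e => ?_⟩
  obtain ⟨V, hV, rfl⟩ := exists_map_eq_of_lt_map hlt
  rw [hneg] at e
  refine hmin (A + V) (add_lt_add_right hV A) ?_ (by rw [Multiset.sum_add, ← e, neg_add_cancel])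
  intro h0
  exact hne (by rw [(add_eq_zero.1 h0).2, Multiset.map_zero])

theorem ZeroSumFree.cons_sub_sum {x : G} (hT : ZeroSumFree T) (hx : ∀ A ≤ T, A.sum ≠ x) :
    ZeroSumFree ((x - T.sum) ::ₘ T) := by
  refine hT.cons fun U hU h => ?_
  obtain ⟨V, rfl⟩ := Multiset.le_iff_exists_add.1 hU
  refine hx V (Multiset.le_add_left _ _) ?_
  rw [Multiset.sum_add, sub_add_eq_add_sub, add_comm, add_sub_add_left_eq_sub, sub_eq_zero] at h
  exact h.symm

theorem ZeroSumFree.exists_isMinimalRep (hT : ZeroSumFree T) (x : G) :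
    ∃ U, IsMinimalRep x U ∧ T.card + 1 ≤ 2 * U.card := by
  by_cases hx : ∃ A ≤ T, A.sum = x
  · obtain ⟨A, hA, rfl⟩ := hx
    obtain ⟨B, rfl⟩ := Multiset.le_iff_exists_add.1 hA
    rw [Multiset.card_add]
    rcases le_total (B.card + 1) A.card with h | h
    · refine ⟨A, (hT.mono hA).isMinimalRep ?_, by lia⟩
      rintro rfl
      simp at h
    · have hmin := hT.isMinimalRep_zero_cons
      rw [← Multiset.add_cons] at hmin
      refine ⟨_, hmin.map_neg Multiset.cons_ne_zero, ?_⟩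
      rw [Multiset.card_map, Multiset.card_cons]
      lia
  · push Not at hx
    refine ⟨_, by simpa using (hT.cons_sub_sum hx).isMinimalRep Multiset.cons_ne_zero, ?_⟩
    rw [Multiset.card_cons]
    lia

end ZeroSumFree

/-! ### Davenport constants -/

section Davenport

variable {G : Type*} [AddCommGroup G]

theorem davenport_eq_iSup (G : Type*) [AddCommGroup G] :
    davenport G = ⨆ (T : Multiset G) (_ : ZeroSumFree T), (T.card + 1 : ℕ∞) := by
  refine le_antisymm (sInf_le fun T hle => ?_) (iSup₂_le fun T hT => le_sInf fun l hl => ?_)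
  · by_contra! hT
    have := (le_iSup₂ (f := fun (T : Multiset G) (_ : ZeroSumFree T) => (T.card + 1 : ℕ∞)) T
      hT).trans hle
    norm_cast at this
    lia
  · by_contra! hlt
    obtain ⟨T', hle, hne, hsum⟩ := hl T (Order.le_of_lt_add_one hlt)
    exact hT T' hle hne hsum

theorem ZeroSumFree.card_add_one_le {T : Multiset G} (hT : ZeroSumFree T) :
    (T.card : ℕ∞) + 1 ≤ davenport G :=
  davenport_eq_iSup G ▸ le_iSup₂_of_le T hT le_rfl

theorem davenport_le {n : ℕ∞} (h : ∀ T : Multiset G, ZeroSumFree T → (T.card + 1 : ℕ∞) ≤ n) :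
    davenport G ≤ n :=
  davenport_eq_iSup G ▸ iSup₂_le h

theorem one_le_davenport (G : Type*) [AddCommGroup G] : 1 ≤ davenport G := by
  simpa using (zeroSumFree_zero (G := G)).card_add_one_le

theorem davenport_le_card (G : Type*) [AddCommGroup G] [Finite G] :
    davenport G ≤ Nat.card G :=
  davenport_le fun _ hT => mod_cast hT.card_lt_natCard

theorem davenport_eq_top (G : Type*) [AddCommGroup G] [Infinite G] : davenport G = ⊤ := by
  refine ENat.eq_top_iff_forall_ge.2 fun n => ?_
  obtain ⟨T, hT, rfl⟩ := exists_zeroSumFree_of_infinite G n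
  exact le_self_add.trans hT.card_add_one_le

theorem davenport_eq_card_of_isAddCyclic (G : Type*) [AddCommGroup G] [Finite G] [IsAddCyclic G] :
    davenport G = Nat.card G := by
  obtain ⟨g, hg⟩ := IsAddCyclic.exists_ofOrder_eq_natCard (α := G)
  refine le_antisymm (davenport_le_card G) ?_
  have h := (zeroSumFree_replicate (Nat.sub_one_lt (addOrderOf_pos g).ne')).card_add_one_le
  rwa [Multiset.card_replicate, ← Nat.cast_add_one, Nat.sub_add_cancel (addOrderOf_pos g), hg] at h

/-- Removing one term makes the image under `f` zero-sum free. -/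
theorem IrreducibleSeq.card_le_davenport {M : Type*} [AddCommMonoid M] {T : Multiset M}
    (hT : IrreducibleSeq T) (f : M →+ G) (hf : ∀ x, f x = 0 → x = 0 ∨ x = T.sum) :
    (T.card : ℕ∞) ≤ davenport G := by
  induction T using Multiset.induction with
  | empty => exact zero_le
  | cons t U _ =>
    have hU : ZeroSumFree (U.map f) := by
      intro T' hle hne h
      obtain ⟨V, hV, rfl⟩ := exists_map_eq_of_le_map hle
      rw [← map_multiset_sum] at h
      rcases hf _ h with h0 | h1
      · obtain ⟨W, rfl⟩ := Multiset.le_iff_exists_add.1 hV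
        refine hT (t ::ₘ W) (Multiset.cons_lt_cons t (lt_add_of_pos_left W ?_)) ?_
        · exact pos_iff_ne_zero.2 (by rintro rfl; exact hne rfl)
        · rw [Multiset.sum_cons, Multiset.sum_cons, Multiset.sum_add, h0, zero_add]
      · exact hT V (hV.trans_lt (Multiset.lt_cons_self U t)) h1
    simpa using hU.card_add_one_le

variable {S : Type*} [AddCommSemigroup S] {a : AdjoinZero S}

theorem IrreducibleSeq.card_le_relDavenport {T : Multiset (AdjoinZero S)} (hT : IrreducibleSeq T)
    (ha : T.sum = a) : (T.card : ℕ∞) ≤ relDavenport a := by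
  have : CanLift (AdjoinZero S) S incl (fun x => x ≠ 0) :=
    ⟨fun x hx => ((eq_zero_or_incl x).resolve_left hx).imp fun _ h => h.symm⟩
  lift T to Multiset S using fun x hx => ne_of_mem_of_not_mem hx hT.zero_notMem
  rw [Multiset.card_map]
  refine le_iSup₂_of_le T ⟨?_, ha⟩ le_rfl
  rintro ⟨T', hlt, h⟩
  exact hT _ (Multiset.map_strictMono _ hlt) h

theorem relDavenport_le {n : ℕ∞} (h : ∀ T : Multiset (AdjoinZero S), IrreducibleSeq T →
    T.sum = a → (T.card : ℕ∞) ≤ n) : relDavenport a ≤ n := by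
  refine iSup₂_le fun T hT => ?_
  have hirr : IrreducibleSeq (T.map incl) := by
    intro T' hlt e
    obtain ⟨U, hU, rfl⟩ := exists_map_eq_of_lt_map hlt
    exact hT.1 ⟨U, hU, e⟩
  simpa only [Multiset.card_map] using h _ hirr hT.2

end Davenport

/-! ### The Schützenberger group -/

section SchutzenbergerGroup

variable {M : Type*} [AddCommMonoid M] {a : M}

theorem mem_hClass_self (a : M) : a ∈ hClass a := rfl

theorem GreenH.add_left {x y : M} (h : GreenH x y) (c : M) : GreenH (c + x) (c + y) := by
  obtain ⟨⟨d, hd⟩, e, he⟩ := mem_hClass_iff.1 (show x ∈ hClass y from h)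
  exact mem_hClass_iff.2 ⟨⟨d, by rw [add_assoc, ← hd]⟩, e, by rw [add_assoc, ← he]⟩

/-- The stabilizer of `H_a` as a submonoid. -/
def stabMonoid (a : M) : AddSubmonoid M where
  carrier := stabilizer (hClass a)
  zero_mem' := fun x hx => by rwa [zero_add]
  add_mem' := fun hc hd x hx => by
    rw [add_assoc]
    exact hc _ (hd x hx)

theorem add_mem_hClass_iff {c x : M} (hx : x ∈ hClass a) :
    c + x ∈ hClass a ↔ c ∈ stabMonoid a := by
  refine ⟨fun h => mem_stabilizer_of_add_mem ?_, fun hc => hc x hx⟩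
  exact ((show GreenH x a from hx).add_left c).symm.trans h

theorem mem_stabMonoid_of_add_mem {c d : M} (h : c + d ∈ stabMonoid a) : c ∈ stabMonoid a := by
  obtain ⟨⟨e, he⟩, -⟩ := mem_hClass_iff.1 (h a (mem_hClass_self a))
  refine mem_stabilizer_of_add_mem (mem_hClass_iff.2 ⟨⟨d + e, ?_⟩, c, add_comm c a⟩)
  rw [← add_assoc, add_right_comm c, ← he]

/-- The homomorphism `c ↦ γ_c` from the stabilizer of `H_a` onto its Schützenberger group. -/
def gammaHom (a : M) : stabMonoid a →+ Schutzenberger a where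
  toFun c := ⟨gammaMap a c, c, rfl⟩
  map_zero' := Subtype.ext (funext fun _ => Subtype.ext (zero_add _))
  map_add' _ _ := Subtype.ext (funext fun _ => Subtype.ext (add_assoc _ _ _))

theorem gammaHom_surjective (a : M) : Function.Surjective (gammaHom a) := by
  rintro ⟨_, c, rfl⟩
  exact ⟨c, rfl⟩

theorem eval_bijective {x : M} (hx : x ∈ hClass a) :
    Function.Bijective fun f : Schutzenberger a => f.1 ⟨x, hx⟩ := by
  have hexists : ∀ y ∈ hClass a, ∃ c, y = c + x := fun y hy => by
    simpa only [add_comm x] using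
      (mem_hClass_iff.1 ((show GreenH y a from hy).trans (show GreenH x a from hx).symm)).2
  constructor
  · intro f g h
    obtain ⟨c, rfl⟩ := gammaHom_surjective a f
    obtain ⟨d, rfl⟩ := gammaHom_surjective a g
    have h : (c : M) + x = d + x := congrArg Subtype.val h
    refine Subtype.ext (funext fun ⟨y, hy⟩ => Subtype.ext ?_)
    obtain ⟨e, rfl⟩ := hexists y hy
    change (c : M) + (e + x) = d + (e + x)
    rw [add_left_comm, h, add_left_comm]
  · rintro ⟨y, hy⟩
    obtain ⟨c, rfl⟩ := hexists y hy
    exact ⟨gammaHom a ⟨c, (add_mem_hClass_iff hx).1 hy⟩, rfl⟩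

theorem gammaHom_eq_iff {c d : stabMonoid a} :
    gammaHom a c = gammaHom a d ↔ (c : M) + a = d + a :=
  (eval_bijective (mem_hClass_self a)).injective.eq_iff.symm.trans Subtype.ext_iff

theorem gammaHom_eq_zero_iff {c : stabMonoid a} : gammaHom a c = 0 ↔ (c : M) + a = a := by
  rw [← map_zero (gammaHom a), gammaHom_eq_iff, AddSubmonoid.coe_zero, zero_add]

theorem zeroSumFree_map_gammaHom_iff {C : Multiset (stabMonoid a)} :
    ZeroSumFree (C.map (gammaHom a)) ↔ ∀ D ≤ C, D ≠ 0 → (D.sum : M) + a ≠ a := by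
  constructor
  · intro h D hD hne hsum
    rw [← gammaHom_eq_zero_iff, map_multiset_sum] at hsum
    exact h _ (Multiset.map_le_map hD) (by simpa using hne) hsum
  · intro h T' hle hne hsum
    obtain ⟨D, hD, rfl⟩ := exists_map_eq_of_le_map hle
    rw [← map_multiset_sum, gammaHom_eq_zero_iff] at hsum
    exact h D hD (by rintro rfl; exact hne rfl) hsum

/-- If `H_a` contains an idempotent `e`, then evaluation at `e` identifies the Schützenberger group
with the group `H_a`. -/
def evalIdempotent {e : M} (he : e ∈ hClass a) (hidem : e + e = e) : Schutzenberger a →ₙ+ M where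
  toFun f := f.1 ⟨e, he⟩
  map_add' f g := by
    obtain ⟨c, rfl⟩ := gammaHom_surjective a f
    obtain ⟨d, rfl⟩ := gammaHom_surjective a g
    change (c : M) + (d + e) = c + e + (d + e)
    rw [add_add_add_comm, hidem, add_assoc]

theorem exists_idempotent_mem_hClass (h : GreenH (a + a) a) : ∃ e ∈ hClass a, e + e = e := by
  obtain ⟨⟨c, hc⟩, -⟩ := mem_hClass_iff.1 (show a + a ∈ hClass a from h)
  have hfix : a + c + a = a := by rw [add_right_comm, ← hc]
  exact ⟨a + c, mem_hClass_iff.2 ⟨⟨a, hfix.symm⟩, c, rfl⟩, by rw [← add_assoc, hfix]⟩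

theorem finite_schutzenberger (h : (hClass a).Finite) : Finite (Schutzenberger a) :=
  have := h.to_subtype
  Finite.of_injective _ (eval_bijective (mem_hClass_self a)).injective

theorem davenport_schutzenberger_ne_top (h : (hClass a).Finite) :
    davenport (Schutzenberger a) ≠ ⊤ :=
  have := finite_schutzenberger h
  ne_top_of_le_ne_top (ENat.natCast_ne_top _) (davenport_le_card _)

theorem davenport_schutzenberger_eq_top (h : (hClass a).Infinite) :
    davenport (Schutzenberger a) = ⊤ :=
  have := h.to_subtype
  have := Infinite.of_surjective _ (eval_bijective (mem_hClass_self a)).surjective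
  davenport_eq_top _

theorem davenport_schutzenberger_of_generator {u : M} {n : ℕ} (hfin : (hClass a).Finite)
    (hu : u ∈ stabMonoid a) (hord : ∀ j : ℕ, j • u + a = a ↔ n ∣ j)
    (hgen : ∀ c ∈ stabMonoid a, ∃ j : ℕ, c + a = j • u + a) :
    davenport (Schutzenberger a) = n := by
  have := finite_schutzenberger hfin
  have hmem : ∀ γ, γ ∈ AddSubgroup.zmultiples (gammaHom a ⟨u, hu⟩) := by
    intro γ
    obtain ⟨c, rfl⟩ := gammaHom_surjective a γ
    obtain ⟨j, hj⟩ := hgen c c.2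
    refine AddSubgroup.mem_zmultiples_iff.2 ⟨j, ?_⟩
    rw [natCast_zsmul, ← map_nsmul]
    exact gammaHom_eq_iff.2 hj.symm
  have hcyclic : IsAddCyclic (Schutzenberger a) := ⟨_, hmem⟩
  have hn : addOrderOf (gammaHom a ⟨u, hu⟩) = n := by
    refine (Nat.dvd_right_iff_eq.1 fun j => ?_).symm
    rw [← hord j, addOrderOf_dvd_iff_nsmul_eq_zero, ← map_nsmul, gammaHom_eq_zero_iff]
    rfl
  rw [davenport_eq_card_of_isAddCyclic, ← addOrderOf_eq_card_of_forall_mem_zmultiples hmem, hn]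

end SchutzenbergerGroup

/-! ### The bounds -/

section Chains

variable {M : Type*} [AddCommMonoid M] {a : M}

theorem principalIdeal_add_subset (x y : M) : principalIdeal (x + y) ⊆ principalIdeal x := by
  rintro _ ⟨c, rfl⟩
  exact ⟨y + c, add_assoc _ _ _⟩

theorem chainLength_add_one_le {b : M} (h : principalIdeal a ⊂ principalIdeal b) :
    chainLength b + 1 ≤ chainLength a := by
  rw [chainLength, ENat.biSup_add' ⟨0, fun _ => b, rfl, fun i => i.elim0⟩]
  refine iSup₂_le fun l ⟨f, hf0, hf⟩ => le_iSup₂_of_le (l + 1) ⟨Fin.cons a f, rfl, fun i => ?_⟩ ?_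
  · cases i using Fin.cases with
    | zero => simpa [hf0] using h
    | succ i => simpa only [Fin.cons_succ, ← Fin.succ_castSucc] using hf i
  · rw [Nat.cast_add_one]

theorem card_le_chainLength {T : Multiset M} (hT : T.sum ∈ hClass a)
    (hmin : ∀ T' < T, T'.sum ∉ hClass a) : (T.card : ℕ∞) ≤ chainLength a := by
  induction T using Multiset.induction generalizing a with
  | empty => exact zero_le
  | cons t U ih =>
    have hlt : principalIdeal a ⊂ principalIdeal U.sum := by
      rw [← show principalIdeal _ = principalIdeal a from hT, Multiset.sum_cons]
      refine (add_comm U.sum t ▸ principalIdeal_add_subset _ _).ssubset_of_ne fun h => ?_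
      exact hmin U (Multiset.lt_cons_self U t) (Eq.trans h.symm (Multiset.sum_cons t U ▸ hT))
    have hU : (U.card : ℕ∞) ≤ chainLength U.sum := by
      refine ih (mem_hClass_self _) fun U' hU' h => ?_
      refine hmin (t ::ₘ U') (Multiset.cons_lt_cons t hU') ?_
      rw [Multiset.sum_cons] at hT ⊢
      exact (GreenH.add_left h t).trans hT
    rw [Multiset.card_cons, Nat.cast_add_one]
    exact (add_le_add_left hU 1).trans (chainLength_add_one_le hlt)

theorem chainLength_le_one (h : ∀ y, principalIdeal a ⊂ principalIdeal y → IsAddUnit y) :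
    chainLength a ≤ 1 := by
  refine iSup₂_le fun l ⟨f, hf0, hf⟩ => ?_
  by_contra! hl
  obtain ⟨k, rfl⟩ := Nat.exists_eq_add_of_le' (Nat.succ_le_of_lt (Nat.one_lt_cast.1 hl))
  obtain ⟨v, hv⟩ := (h (f 1) (hf0 ▸ hf 0)).exists_neg
  exact (hf 1).2 fun x _ => ⟨v + x, show x = f 1 + (v + x) by rw [← add_assoc, hv, zero_add]⟩

theorem chainLength_ne_top [Finite M] (a : M) : chainLength a ≠ ⊤ := by
  refine ne_top_of_le_ne_top (ENat.natCast_ne_top (Nat.card M)) (iSup₂_le fun l ⟨f, _, hf⟩ => ?_)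
  have hmono : StrictMono (principalIdeal ∘ f) := Fin.strictMono_iff_lt_succ.2 hf
  have hcard := Nat.card_le_card_of_injective f hmono.injective.of_comp
  rw [Nat.card_fin] at hcard
  exact_mod_cast (Nat.le_succ l).trans hcard

end Chains

section UpperBound

variable {M : Type*} [AddCommMonoid M] {a : M}

theorem mem_stabMonoid_of_mem {A B : Multiset M} (hA : A.sum ∈ hClass a)
    (hAB : (A + B).sum ∈ hClass a) {b : M} (hb : b ∈ B) : b ∈ stabMonoid a := by
  rw [Multiset.sum_add, add_comm, add_mem_hClass_iff hA] at hAB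
  obtain ⟨C, rfl⟩ := Multiset.exists_cons_of_mem hb
  rw [Multiset.sum_cons] at hAB
  exact mem_stabMonoid_of_add_mem hAB

theorem IrreducibleSeq.zeroSumFree_map_gammaHom {A : Multiset M} {C : Multiset (stabMonoid a)}
    (h : IrreducibleSeq (A + C.map (↑))) (hA : A.sum ∈ hClass a) :
    ZeroSumFree (C.map (gammaHom a)) := by
  refine zeroSumFree_map_gammaHom_iff.2 fun D hD hne hsum => ?_
  obtain ⟨E, rfl⟩ := Multiset.le_iff_exists_add.1 hD
  refine h (A + E.map (↑)) (add_lt_add_right (Multiset.map_strictMono _ ?_) A) ?_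
  · exact lt_add_of_pos_left E (pos_iff_ne_zero.2 hne)
  · have hfix := fix_hClass hsum hA
    rw [AddSubmonoid.coe_multiset_sum] at hfix
    rw [Multiset.map_add, Multiset.sum_add, Multiset.sum_add, Multiset.sum_add, add_left_comm,
      ← add_assoc, hfix]

theorem IrreducibleSeq.card_add_one_le {T : Multiset M} (hT : IrreducibleSeq T)
    (ha : T.sum = a) :
    (T.card : ℕ∞) + 1 ≤ chainLength a + davenport (Schutzenberger a) := by
  have haT : T.sum ∈ hClass a := ha ▸ mem_hClass_self _
  obtain ⟨A, ⟨hAT, hA⟩, hmin⟩ := WellFounded.has_min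
    (wellFounded_lt (α := Multiset M)) {A | A ≤ T ∧ A.sum ∈ hClass a} ⟨T, le_rfl, haT⟩
  have hcardA : (A.card : ℕ∞) ≤ chainLength a :=
    card_le_chainLength hA fun A' hlt h => hmin A' ⟨hlt.le.trans hAT, h⟩ hlt
  obtain ⟨B, rfl⟩ := Multiset.le_iff_exists_add.1 hAT
  lift B to Multiset (stabMonoid a) using fun b => mem_stabMonoid_of_mem hA haT
  have hcardB := (hT.zeroSumFree_map_gammaHom hA).card_add_one_le
  rw [Multiset.card_map] at hcardB
  rw [Multiset.card_add, Multiset.card_map, Nat.cast_add, add_assoc]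
  exact add_le_add hcardA hcardB

theorem relDavenport_add_one_le {S : Type*} [AddCommSemigroup S] (a : AdjoinZero S) :
    relDavenport a + 1 ≤ chainLength a + davenport (Schutzenberger a) := by
  have hone : 1 ≤ chainLength a + davenport (Schutzenberger a) :=
    (one_le_davenport _).trans le_add_self
  rw [← tsub_add_cancel_of_le hone]
  gcongr
  exact relDavenport_le fun T hT ha =>
    ENat.le_sub_of_add_le_right ENat.one_ne_top (hT.card_add_one_le ha)

theorem relDavenport_ne_top {S : Type*} [AddCommSemigroup S] {a : AdjoinZero S}
    (hfin : (hClass a).Finite) (hΨ : chainLength a ≠ ⊤) : relDavenport a ≠ ⊤ :=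
  ne_top_of_le_ne_top (WithTop.add_ne_top.2 ⟨hΨ, davenport_schutzenberger_ne_top hfin⟩)
    (le_self_add.trans (relDavenport_add_one_le a))

end UpperBound

section Extension

variable {M : Type*} [AddCommMonoid M] {a : M} {N : AddSubmonoid M}

theorem irreducibleSeq_add {Q C : Multiset M} (hsum : Q.sum + C.sum = a)
    (hQ : ∀ Q' < Q, ∀ c ∈ N, c + Q'.sum ≠ a) (hCN : ∀ c ∈ C, c ∈ N)
    (hC : ∀ D ≤ C, D ≠ 0 → D.sum + a ≠ a) : IrreducibleSeq (Q + C) := by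
  intro T' hlt h
  obtain ⟨A, hA, B, hB, rfl⟩ := exists_eq_add_of_le_add hlt.le
  rw [Multiset.sum_add, Multiset.sum_add, hsum] at h
  rcases hA.lt_or_eq with hA | rfl
  · refine hQ A hA B.sum (multiset_sum_mem _ fun c hc => hCN c (Multiset.mem_of_le hB hc)) ?_
    rw [add_comm, h]
  · obtain ⟨D, rfl⟩ := Multiset.le_iff_exists_add.1 hB
    refine hC D (Multiset.le_add_left _ _) (by rintro rfl; simp at hlt) ?_
    rwa [Multiset.sum_add, ← add_assoc, h, add_comm] at hsum

theorem add_sum_ne_of_lt_add_cons {q v : M} {Q : Multiset M} (hv : v ∈ N)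
    (hQ : ∀ Q' < q ::ₘ Q, ∀ c ∈ N, c + Q'.sum ≠ a) :
    ∀ Q' < (v + q) ::ₘ Q, ∀ c ∈ N, c + Q'.sum ≠ a := by
  intro Q' hlt c hc
  rcases le_cons_cases hlt.le with hle | ⟨U, -, rfl⟩
  · exact hQ Q' (hle.trans_lt (Multiset.lt_cons_self Q q)) c hc
  · have := hQ (q ::ₘ U) (Multiset.cons_lt_cons q (Multiset.cons_lt_cons_iff.1 hlt)) (c + v)
      (add_mem hc hv)
    rwa [Multiset.sum_cons, add_assoc, ← add_assoc v, ← Multiset.sum_cons] at this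

/-- The terms of `T` are lifted to `N`, and one term of `Q` is translated by an element of `N` to
correct the sum. -/
theorem exists_irreducibleSeq_card_eq
    (hN : ∀ γ : Schutzenberger a, ∃ c : stabMonoid a, (c : M) ∈ N ∧ gammaHom a c = γ)
    {Q : Multiset M} (hQ0 : Q ≠ 0) (hQa : Q.sum ∈ hClass a)
    (hQ : ∀ Q' < Q, ∀ c ∈ N, c + Q'.sum ≠ a) {T : Multiset (Schutzenberger a)}
    (hT : ZeroSumFree T) :
    ∃ W : Multiset M, IrreducibleSeq W ∧ W.sum = a ∧ W.card = Q.card + T.card := by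
  choose s hsN hs using hN
  obtain ⟨C, hCN, rfl⟩ : ∃ C : Multiset (stabMonoid a), (∀ c ∈ C, (c : M) ∈ N) ∧
      C.map (gammaHom a) = T := by
    refine ⟨T.map s, fun c hc => ?_, by simp [hs]⟩
    obtain ⟨γ, -, rfl⟩ := Multiset.mem_map.1 hc
    exact hsN γ
  rw [zeroSumFree_map_gammaHom_iff] at hT
  obtain ⟨v, hvN, hv⟩ : ∃ v ∈ N, v + C.sum + Q.sum = a := by
    obtain ⟨γ, hγ⟩ := (eval_bijective hQa).surjective ⟨a, mem_hClass_self a⟩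
    have hlift : gammaHom a (s (γ - gammaHom a C.sum) + C.sum) = γ := by
      rw [map_add, hs, sub_add_cancel]
    rw [← hlift] at hγ
    exact ⟨_, hsN _, congrArg Subtype.val hγ⟩
  obtain ⟨q, hq⟩ := Multiset.exists_mem_of_ne_zero hQ0
  obtain ⟨Q, rfl⟩ := Multiset.exists_cons_of_mem hq
  have hsum : ((v + q) ::ₘ Q).sum + (C.map ((↑) : stabMonoid a → M)).sum = a := by
    refine Eq.trans ?_ hv
    rw [← AddSubmonoid.coe_multiset_sum, Multiset.sum_cons, Multiset.sum_cons]
    abel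
  refine ⟨(v + q) ::ₘ Q + C.map (↑), irreducibleSeq_add hsum
    (add_sum_ne_of_lt_add_cons hvN hQ) ?_ ?_, by rw [Multiset.sum_add, hsum],
    by simp [add_right_comm]⟩
  · simpa using fun c hc hcC => hCN ⟨c, hc⟩ hcC
  · intro D hD hne
    obtain ⟨E, hE, rfl⟩ := exists_map_eq_of_le_map hD
    rw [← AddSubmonoid.coe_multiset_sum]
    exact hT E hE (by rintro rfl; exact hne rfl)

end Extension

section LowerBound

variable {S : Type*} [AddCommSemigroup S] {a : AdjoinZero S}

theorem card_add_davenport_le {N : AddSubmonoid (AdjoinZero S)}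
    (hN : ∀ γ : Schutzenberger a, ∃ c : stabMonoid a, ↑c ∈ N ∧ gammaHom a c = γ)
    {Q : Multiset (AdjoinZero S)} (hQ0 : Q ≠ 0) (hQa : Q.sum ∈ hClass a)
    (hQ : ∀ Q' < Q, ∀ c ∈ N, c + Q'.sum ≠ a) :
    Q.card + davenport (Schutzenberger a) ≤ relDavenport a + 1 := by
  rw [davenport_eq_iSup, ENat.add_biSup' ⟨0, zeroSumFree_zero⟩]
  refine iSup₂_le fun T hT => ?_
  obtain ⟨W, hW, hsum, hcard⟩ := exists_irreducibleSeq_card_eq hN hQ0 hQa hQ hT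
  rw [← add_assoc, ← Nat.cast_add, ← hcard]
  gcongr
  exact hW.card_le_relDavenport hsum

theorem davenport_le_relDavenport (h : ¬ GreenH (a + a) a) :
    davenport (Schutzenberger a) ≤ relDavenport a := by
  have hstab : ∀ c ∈ stabMonoid a, c ≠ a := by
    rintro c hc rfl
    exact h (hc _ (mem_hClass_self _))
  have hlift : ∀ γ, ∃ c : stabMonoid a, ↑c ∈ stabMonoid a ∧ gammaHom a c = γ := fun γ =>
    (gammaHom_surjective a γ).imp fun c hc => ⟨c.2, hc⟩
  have hle := card_add_davenport_le (Q := {a}) hlift (Multiset.singleton_ne_zero a)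
    (by rw [Multiset.sum_singleton]; exact mem_hClass_self a) fun Q' hQ' c hc => by
      rw [Multiset.lt_singleton.1 hQ', Multiset.sum_zero, add_zero]
      exact hstab c hc
  rwa [Multiset.card_singleton, Nat.cast_one, add_comm, ENat.add_le_add_iff_right ENat.one_ne_top]
    at hle

theorem davenport_le_two_mul_relDavenport (h0 : a ≠ 0) (h : GreenH (a + a) a) :
    davenport (Schutzenberger a) ≤ 2 * relDavenport a := by
  obtain ⟨e, he, hidem⟩ := exists_idempotent_mem_hClass h
  have hbij := eval_bijective he
  have hinj : Function.Injective (evalIdempotent he hidem) :=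
    Subtype.val_injective.comp hbij.injective
  obtain ⟨x, hx⟩ := hbij.surjective ⟨a, mem_hClass_self a⟩
  have hxa : evalIdempotent he hidem x = a := congrArg Subtype.val hx
  refine davenport_le fun T hT => ?_
  obtain ⟨U, hU, hcard⟩ := hT.exists_isMinimalRep x
  obtain ⟨hirr, hsum⟩ := hU.irreducibleSeq_map hinj (by rwa [hxa])
  have hle := hirr.card_le_relDavenport (hsum.trans hxa)
  rw [Multiset.card_map] at hle
  calc (T.card : ℕ∞) + 1 ≤ 2 * U.card := mod_cast hcard
    _ ≤ 2 * relDavenport a := by gcongr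

theorem epsilon_mul_davenport_le (h0 : a ≠ 0) :
    epsilon a * (davenport (Schutzenberger a) : ℝ≥0∞) ≤ (relDavenport a : ℝ≥0∞) := by
  unfold epsilon
  split_ifs with h
  · have hle := ENat.toENNReal_le.2 (davenport_le_two_mul_relDavenport h0 h)
    rw [ENat.toENNReal_mul, ENat.toENNReal_ofNat] at hle
    rwa [one_div, ENNReal.inv_mul_le_iff two_ne_zero ENNReal.ofNat_ne_top]
  · rw [one_mul, ENat.toENNReal_le]
    exact davenport_le_relDavenport h

theorem relDavenport_eq_top (h0 : a ≠ 0) (h : (hClass a).Infinite) : relDavenport a = ⊤ := by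
  have hD := davenport_schutzenberger_eq_top h
  by_cases hG : GreenH (a + a) a
  · have := hD.ge.trans (davenport_le_two_mul_relDavenport h0 hG)
    rw [top_le_iff, two_mul] at this
    exact or_self_iff.1 (WithTop.add_eq_top.1 this)
  · exact top_le_iff.1 (hD.ge.trans (davenport_le_relDavenport hG))

end LowerBound

/-! ### Generators and relations -/

section Lifts

variable {S N : Type*} [AddCommSemigroup S] [AddCommMonoid N]

/-- The extension to `S⁰` of a homomorphism of `S` to a monoid. If `S` has an identity element,
it has to be mapped to `0`. -/
def adjoinZeroLift (f : S →ₙ+ N) (hf : ∀ e : S, (∀ s, e + s = s) → f e = 0) :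
    AdjoinZero S →+ N :=
  (zeroCon S).lift (WithZero.lift f) <| by
    have key : ∀ x : WithZero S, (∀ s : S, x + (s : WithZero S) = s) →
        WithZero.lift f x = 0 := by
      intro x hx
      cases x with
      | zero => exact map_zero _
      | coe e => exact hf e fun s => WithZero.coe_inj.1 (hx s)
    rintro x y (h | ⟨hx, hy⟩)
    · exact congrArg _ h
    · exact (key x hx).trans (key y hy).symm

theorem adjoinZeroLift_incl (f : S →ₙ+ N) (hf : ∀ e : S, (∀ s, e + s = s) → f e = 0) (s : S) :
    adjoinZeroLift f hf (incl s) = f s :=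
  rfl

variable {X : Type*} {r : Multiset X → Multiset X → Prop}

/-- The homomorphism on the free commutative semigroup given by the images of the generators. -/
def wordSum (φ : X → N) : FreeCommSemigroup X →ₙ+ N where
  toFun u := (u.1.map φ).sum
  map_add' u v := (congrArg Multiset.sum (Multiset.map_add φ u.1 v.1)).trans (Multiset.sum_add _ _)

/-- The homomorphism on `⟨X | r⟩` given by the images of the generators. -/
def presentedLift (φ : X → N) (hφ : ∀ u v, r u v → (u.map φ).sum = (v.map φ).sum) :
    Presented r →ₙ+ N where
  toFun q := AddCon.liftOn q (wordSum φ) fun _ _ h =>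
    AddCon.addConGen_le (c := AddCon.ker (wordSum φ)).2 (fun _ _ h => hφ _ _ h) h
  map_add' p q := AddCon.induction_on₂ p q fun u v => map_add (wordSum φ) u v

theorem presentedLift_gen (φ : X → N) (hφ : ∀ u v, r u v → (u.map φ).sum = (v.map φ).sum)
    (x : X) : presentedLift φ hφ (gen r x) = φ x := by
  change (Multiset.map φ {x}).sum = φ x
  rw [Multiset.map_singleton, Multiset.sum_singleton]

theorem incl_toQuotient (u : FreeCommSemigroup X) :
    incl (AddCon.toQuotient u : Presented r) = (u.1.map fun x => incl (gen r x)).sum := by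
  obtain ⟨m, hm⟩ := u
  induction m using Multiset.induction with
  | empty => exact absurd rfl hm
  | cons x m ih =>
    obtain rfl | h := eq_or_ne m 0
    · rw [Multiset.map_cons, Multiset.map_zero, Multiset.sum_cons, Multiset.sum_zero, add_zero]
      rfl
    · rw [Multiset.map_cons, Multiset.sum_cons, ← ih h]
      rfl

theorem sum_incl_gen_eq {u v : Multiset X} (hu : u ≠ 0) (hv : v ≠ 0) (h : r u v) :
    (u.map fun x => incl (gen r x)).sum = (v.map fun x => incl (gen r x)).sum := by
  rw [← incl_toQuotient ⟨u, hu⟩, ← incl_toQuotient ⟨v, hv⟩]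
  exact congrArg incl ((AddCon.eq _).2 (AddConGen.Rel.of _ _ h))

theorem presented_induction_incl {p : AdjoinZero (Presented r) → Prop}
    (hgen : ∀ x, p (incl (gen r x))) (hadd : ∀ x y, p x → p y → p (x + y)) (s : Presented r) :
    p (incl s) := by
  induction s using AddCon.induction_on with
  | H u =>
    rw [incl_toQuotient]
    refine Multiset.sum_induction_nonempty p hadd (Multiset.map_eq_zero.not.2 u.2) fun y hy => ?_
    obtain ⟨x, -, rfl⟩ := Multiset.mem_map.1 hy
    exact hgen x

theorem presented_induction {p : AdjoinZero (Presented r) → Prop} (hzero : p 0)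
    (hgen : ∀ x, p (incl (gen r x))) (hadd : ∀ x y, p x → p y → p (x + y))
    (x : AdjoinZero (Presented r)) : p x := by
  obtain rfl | ⟨s, rfl⟩ := eq_zero_or_incl x
  · exact hzero
  · exact presented_induction_incl hgen hadd s

end Lifts

theorem nsmul_eq_of_modEq {M : Type*} [AddCommMonoid M] {x : M} {n : ℕ} (hx : (n + 1) • x = x)
    {i j : ℕ} (hi : 0 < i) (hj : 0 < j) (h : i ≡ j [MOD n]) : i • x = j • x := by
  have hper : Function.IsPeriodicPt (x + ·) n x := by
    rw [Function.IsPeriodicPt, add_left_iterate, Function.IsFixedPt, ← succ_nsmul, hx]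
  have hiter : ∀ t, (t + 1) • x = (x + ·)^[t] x := fun t => by
    rw [add_left_iterate, succ_nsmul]
  obtain ⟨i, rfl⟩ := Nat.exists_eq_add_one.2 hi
  obtain ⟨j, rfl⟩ := Nat.exists_eq_add_one.2 hj
  have hmod : i % n = j % n := Nat.ModEq.add_right_cancel' 1 h
  rw [hiter, hiter, ← hper.iterate_mod_apply, hmod, hper.iterate_mod_apply]

/-! ### A chain of cyclic groups -/

section Chain

variable {n r : ℕ}

/-- The generator `x_i` of the semigroup of the first example, as an element of `S⁰`. -/
def chainGen (n : ℕ) {r : ℕ} (i : Fin r) : AdjoinZero (Presented (ChainRel n r)) :=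
  incl (gen (ChainRel n r) i)

theorem chainGen_period (i : Fin r) : (n + 1) • chainGen n i = chainGen n i := by
  simpa [Multiset.map_nsmul, Multiset.sum_nsmul, chainGen] using
    sum_incl_gen_eq (by simp) (by simp) (ChainRel.period (n := n) i)

theorem chainGen_absorb {i j : Fin r} (h : i < j) :
    chainGen n i + chainGen n j = chainGen n j := by
  simpa [chainGen] using sum_incl_gen_eq (by simp) (by simp) (ChainRel.absorb (n := n) i j h)

theorem nsmul_chainGen_absorb {i j : Fin r} (h : i < j) (s : ℕ) {t : ℕ} (ht : 0 < t) :
    s • chainGen n i + t • chainGen n j = t • chainGen n j := by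
  have hone : s • chainGen n i + chainGen n j = chainGen n j := by
    induction s with
    | zero => rw [zero_nsmul, zero_add]
    | succ s ih => rw [succ_nsmul, add_assoc, chainGen_absorb h, ih]
  obtain ⟨t, rfl⟩ := Nat.exists_eq_add_one.2 ht
  rw [succ_nsmul, add_left_comm, hone]

theorem exists_eq_nsmul_chainGen (k : Fin r) (x : AdjoinZero (Presented (ChainRel n r))) :
    ∃ (i : Fin r) (j : ℕ), x = j • chainGen n i := by
  induction x using presented_induction with
  | hzero => exact ⟨k, 0, (zero_nsmul _).symm⟩
  | hgen i => exact ⟨i, 1, (one_nsmul _).symm⟩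
  | hadd _ _ hx hy =>
    obtain ⟨i, s, rfl⟩ := hx
    obtain ⟨j, t, rfl⟩ := hy
    rcases Nat.eq_zero_or_pos s with rfl | hs
    · exact ⟨j, t, by rw [zero_nsmul, zero_add]⟩
    rcases Nat.eq_zero_or_pos t with rfl | ht
    · exact ⟨i, s, by rw [zero_nsmul, add_zero]⟩
    rcases lt_trichotomy i j with h | rfl | h
    · exact ⟨j, t, nsmul_chainGen_absorb h s ht⟩
    · exact ⟨i, s + t, (add_nsmul _ _ _).symm⟩
    · exact ⟨i, s, by rw [add_comm, nsmul_chainGen_absorb h t hs]⟩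

theorem finite_chain (hn : 0 < n) (k : Fin r) :
    Finite (AdjoinZero (Presented (ChainRel n r))) := by
  refine Finite.of_surjective
    (fun p : Fin r × Fin (n + 1) => (p.2 : ℕ) • chainGen n p.1) fun x => ?_
  obtain ⟨i, j, rfl⟩ := exists_eq_nsmul_chainGen k x
  rcases Nat.eq_zero_or_pos j with rfl | hj
  · exact ⟨(i, 0), rfl⟩
  · obtain ⟨j, rfl⟩ := Nat.exists_eq_add_one.2 hj
    refine ⟨(i, ⟨j % n + 1, Nat.succ_lt_succ (Nat.mod_lt j hn)⟩), ?_⟩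
    exact nsmul_eq_of_modEq (chainGen_period i) (Nat.succ_pos _) hj
      ((Nat.mod_modEq j n).add_right 1)

/-- The homomorphism `chainHom n k` on generators. -/
def chainValue (n : ℕ) {r : ℕ} (k i : Fin r) : WithTop (ZMod n) :=
  if i < k then 0 else if i = k then ((1 : ZMod n) : WithTop (ZMod n)) else ⊤

theorem chainValue_self (k : Fin r) : chainValue n k k = ((1 : ZMod n) : WithTop (ZMod n)) := by
  rw [chainValue, if_neg (lt_irrefl k), if_pos rfl]

theorem chainValue_of_lt {i k : Fin r} (h : i < k) : chainValue n k i = 0 := if_pos h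

theorem chainValue_of_gt {i k : Fin r} (h : k < i) : chainValue n k i = ⊤ := by
  rw [chainValue, if_neg h.not_gt, if_neg h.ne']

theorem sum_chainValue_eq (k : Fin r) (u v : Multiset (Fin r)) (h : ChainRel n r u v) :
    (u.map (chainValue n k)).sum = (v.map (chainValue n k)).sum := by
  rcases h with i | ⟨i, j, h⟩
  · rw [Multiset.map_nsmul, Multiset.sum_nsmul, Multiset.map_singleton, Multiset.sum_singleton]
    rcases lt_trichotomy i k with h | rfl | h
    · rw [chainValue_of_lt h, smul_zero]
    · rw [chainValue_self, ← WithTop.coe_nsmul, succ_nsmul, nsmul_one, ZMod.natCast_self, zero_add]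
    · rw [chainValue_of_gt h, succ_nsmul, WithTop.add_top]
  · rw [Multiset.map_add, Multiset.sum_add, Multiset.map_singleton, Multiset.map_singleton,
      Multiset.sum_singleton, Multiset.sum_singleton]
    rcases lt_or_ge k j with hk | hk
    · rw [chainValue_of_gt hk, WithTop.add_top]
    · rw [chainValue_of_lt (h.trans_le hk), zero_add]

/-- The homomorphism to `ℤ/n ∪ {⊤}` that isolates the component of `x_k`: it maps `x_i` to `0`,
`1` or `⊤` according to whether `i < k`, `i = k` or `i > k`. -/
def chainHom (n : ℕ) {r : ℕ} (k : Fin r) :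
    AdjoinZero (Presented (ChainRel n r)) →+ WithTop (ZMod n) :=
  adjoinZeroLift (presentedLift (chainValue n k) (sum_chainValue_eq k)) fun e he => by
    have h := congrArg (presentedLift (chainValue n k) (sum_chainValue_eq k)) (he (gen _ k))
    rw [map_add, presentedLift_gen, chainValue_self] at h
    exact WithTop.add_right_cancel WithTop.coe_ne_top (h.trans (zero_add _).symm)

theorem chainHom_chainGen (k i : Fin r) : chainHom n k (chainGen n i) = chainValue n k i := by
  rw [chainHom, chainGen, adjoinZeroLift_incl, presentedLift_gen]

theorem chainHom_nsmul_self (k : Fin r) (j : ℕ) :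
    chainHom n k (j • chainGen n k) = ((j : ZMod n) : WithTop (ZMod n)) := by
  rw [map_nsmul, chainHom_chainGen, chainValue_self, ← WithTop.coe_nsmul, nsmul_one]

theorem exists_of_chainHom_ne_top {k : Fin r} {x : AdjoinZero (Presented (ChainRel n r))}
    (hx : chainHom n k x ≠ ⊤) : ∃ i ≤ k, ∃ j : ℕ, x = j • chainGen n i := by
  obtain ⟨i, j, rfl⟩ := exists_eq_nsmul_chainGen k x
  rcases le_or_gt i k with hi | hi
  · exact ⟨i, hi, j, rfl⟩
  · obtain rfl : j = 0 := by
      by_contra hj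
      obtain ⟨j, rfl⟩ := Nat.exists_eq_succ_of_ne_zero hj
      rw [map_nsmul, chainHom_chainGen, chainValue_of_gt hi, Nat.succ_eq_add_one, succ_nsmul,
        WithTop.add_top] at hx
      exact hx rfl
    exact ⟨k, le_rfl, 0, by rw [zero_nsmul, zero_nsmul]⟩

theorem nsmul_chainGen_eq_iff {k : Fin r} {i j : ℕ} (hi : 0 < i) (hj : 0 < j) :
    i • chainGen n k = j • chainGen n k ↔ i ≡ j [MOD n] := by
  refine ⟨fun h => ?_, nsmul_eq_of_modEq (chainGen_period k) hi hj⟩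
  have h := congrArg (chainHom n k) h
  rwa [chainHom_nsmul_self, chainHom_nsmul_self, WithTop.coe_inj, ZMod.natCast_eq_natCast_iff] at h

theorem eq_of_chainHom_eq {k : Fin r} {x : AdjoinZero (Presented (ChainRel n r))} {s : ℕ}
    (hs : (s : ZMod n) ≠ 0) (h : chainHom n k x = ((s : ZMod n) : WithTop (ZMod n))) :
    x = s • chainGen n k := by
  obtain ⟨i, hi, j, rfl⟩ := exists_of_chainHom_ne_top (h ▸ WithTop.coe_ne_top)
  rcases hi.lt_or_eq with hi | rfl
  · rw [map_nsmul, chainHom_chainGen, chainValue_of_lt hi, smul_zero] at h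
    exact absurd (WithTop.coe_eq_zero.1 h.symm) hs
  · rw [chainHom_nsmul_self, WithTop.coe_inj] at h
    have hpos : ∀ t : ℕ, (t : ZMod n) ≠ 0 → 0 < t := fun t ht =>
      Nat.pos_of_ne_zero (by rintro rfl; exact ht Nat.cast_zero)
    exact (nsmul_chainGen_eq_iff (hpos j (h ▸ hs)) (hpos s hs)).2
      ((ZMod.natCast_eq_natCast_iff _ _ _).1 h)

theorem davenport_chain {s : ℕ} (hn : 0 < n) (hs : 0 < s) (k : Fin r) :
    davenport (Schutzenberger (s • chainGen n k)) = n := by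
  have := finite_chain hn k
  refine davenport_schutzenberger_of_generator (u := chainGen n k) (Set.toFinite _) ?_ ?_ ?_
  · refine mem_stabilizer_of_add_mem (mem_hClass_iff.2 ⟨⟨(n - 1) • chainGen n k, ?_⟩, _,
      add_comm _ _⟩)
    rw [← succ_nsmul', ← add_nsmul, nsmul_chainGen_eq_iff hs (by omega),
      show s + 1 + (n - 1) = s + n by omega]
    exact Nat.add_modEq_right.symm
  · intro j
    rw [← add_nsmul, nsmul_chainGen_eq_iff (by omega) hs, ← Nat.modEq_zero_iff_dvd]
    exact ⟨fun h => Nat.ModEq.add_right_cancel' s (by rwa [zero_add]),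
      fun h => by simpa using h.add_right s⟩
  · intro c hc
    obtain ⟨⟨d, hd⟩, -⟩ := mem_hClass_iff.1 (hc _ (mem_hClass_self _))
    have htop : chainHom n k c ≠ ⊤ := by
      intro htop
      have h := congrArg (chainHom n k) hd
      rw [map_add, map_add, htop, WithTop.top_add, WithTop.top_add, chainHom_nsmul_self] at h
      exact WithTop.coe_ne_top h
    obtain ⟨i, hi, j, rfl⟩ := exists_of_chainHom_ne_top htop
    rcases hi.lt_or_eq with hi | rfl
    · exact ⟨0, by rw [nsmul_chainGen_absorb hi j hs, zero_nsmul, zero_add]⟩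
    · exact ⟨j, rfl⟩

theorem natCast_half_ne_zero {h : ℕ} (hh : 0 < h) : (h : ZMod (2 * h)) ≠ 0 := by
  rw [Ne, ZMod.natCast_eq_zero_iff]
  exact Nat.not_dvd_of_pos_of_lt hh (by omega)

theorem eq_zero_or_eq_half {h : ℕ} (hh : 0 < h) {x : ZMod (2 * h)}
    (hx : ZMod.castHom (Dvd.intro_left 2 rfl) (ZMod h) x = 0) : x = 0 ∨ x = h := by
  have : NeZero (2 * h) := ⟨by omega⟩
  obtain ⟨c, hc⟩ : h ∣ x.val := by
    rwa [← ZMod.natCast_eq_zero_iff, ← map_natCast (ZMod.castHom (Dvd.intro_left 2 rfl) _),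
      ZMod.natCast_zmod_val]
  have hc2 : c < 2 := by
    have hlt := hc ▸ ZMod.val_lt x
    exact Nat.lt_of_mul_lt_mul_left (mul_comm 2 h ▸ hlt)
  rw [← ZMod.natCast_zmod_val x, hc]
  interval_cases c
  · exact .inl (by rw [mul_zero, Nat.cast_zero])
  · exact .inr (by rw [mul_one])

/-- The sequence is carried to `ℤ/2h` by `chainHom`, where its sum is `h`, and then to `ℤ/h`, so
that the subsequences with sum `0` or `h` become those with sum `0`. -/
theorem card_le_of_irreducibleSeq_chain {h : ℕ} (hh : 0 < h) (k : Fin r)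
    {T : Multiset (AdjoinZero (Presented (ChainRel (2 * h) r)))} (hT : IrreducibleSeq T)
    (hs : T.sum = h • chainGen (2 * h) k) : T.card ≤ h := by
  have : NeZero h := ⟨hh.ne'⟩
  have hsum : (T.map (chainHom (2 * h) k)).sum = ((h : ZMod (2 * h)) : WithTop (ZMod (2 * h))) := by
    rw [← map_multiset_sum, hs, chainHom_nsmul_self]
  have hirr : IrreducibleSeq (T.map (chainHom (2 * h) k)) := hT.map _ fun x hx => by
    rw [hs] at hx ⊢
    exact eq_of_chainHom_eq (natCast_half_ne_zero hh) (hx.trans (chainHom_nsmul_self k h))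
  rw [← Multiset.card_map (chainHom (2 * h) k)]
  generalize T.map (chainHom (2 * h) k) = U at hsum hirr
  lift U to Multiset (ZMod (2 * h)) using by
    rintro _ hx rfl
    obtain ⟨V, rfl⟩ := Multiset.exists_cons_of_mem hx
    exact WithTop.top_ne_coe ((Multiset.sum_cons _ _).symm.trans hsum)
  have hsumU : U.sum = h :=
    WithTop.coe_injective ((map_multiset_sum WithTop.addHom U).trans hsum)
  have hle := (IrreducibleSeq.of_map (f := WithTop.addHom) hirr).card_le_davenport
    (ZMod.castHom (Dvd.intro_left 2 rfl) (ZMod h)).toAddMonoidHom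
    fun x hx => hsumU ▸ eq_zero_or_eq_half hh hx
  have hcard := hle.trans (davenport_le_card _)
  rw [Nat.card_zmod, Nat.cast_le] at hcard
  rwa [Multiset.card_map]

theorem chain_sharp {h r : ℕ} (k : Fin r) (hh : 0 < h)
    {a : AdjoinZero (Presented (ChainRel (2 * h) r))} (ha : a = h • chainGen (2 * h) k) :
    a ≠ 0 ∧ chainLength a ≠ ⊤ ∧ (hClass a).Finite ∧ GreenH (a + a) a ∧
      davenport (Schutzenberger a) = (2 * h : ℕ) ∧
      epsilon a * (davenport (Schutzenberger a) : ℝ≥0∞) = (relDavenport a : ℝ≥0∞) := by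
  have := finite_chain (n := 2 * h) (by omega) k
  have h0 : a ≠ 0 := by
    rintro rfl
    have h := congrArg (chainHom (2 * h) k) ha
    rw [chainHom_nsmul_self, map_zero] at h
    exact natCast_half_ne_zero hh (WithTop.coe_eq_zero.1 h.symm)
  have hG : GreenH (a + a) a := by
    refine mem_hClass_iff.2 ⟨⟨a, ?_⟩, a, rfl⟩
    rw [ha, ← add_nsmul, ← add_nsmul, nsmul_chainGen_eq_iff hh (by omega), add_assoc, ← two_mul]
    exact Nat.add_modEq_right.symm
  have hD : davenport (Schutzenberger a) = (2 * h : ℕ) := ha ▸ davenport_chain (by omega) hh k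
  have hle : relDavenport a ≤ h := relDavenport_le fun T hT hs =>
    Nat.cast_le.2 (card_le_of_irreducibleSeq_chain hh k hT (hs.trans ha))
  refine ⟨h0, chainLength_ne_top a, Set.toFinite _, hG, hD,
    le_antisymm (epsilon_mul_davenport_le h0) ((ENat.toENNReal_le.2 hle).trans_eq ?_)⟩
  rw [hD, epsilon, if_pos hG, ENat.toENNReal_coe, ENat.toENNReal_coe, Nat.cast_mul, Nat.cast_ofNat,
    ← mul_assoc, one_div, ENNReal.inv_mul_cancel two_ne_zero ENNReal.ofNat_ne_top, one_mul]

end Chain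

/-! ### A torsor under a cyclic group, with a zero element -/

section Torsor

variable {m : ℕ}

/-- The generator `x_0` of the semigroup of the second example, as an element of `S⁰`. -/
def torsorBase (m : ℕ) : AdjoinZero (Presented (TorsorRel m)) := incl (gen (TorsorRel m) .base)

/-- The generator `x_k` of the second example, as an element of `S⁰`, for `k` modulo `m`. -/
def torsorPoint (k : ZMod m) : AdjoinZero (Presented (TorsorRel m)) :=
  incl (gen (TorsorRel m) (.point k))

/-- The zero element `∞` of the second example, as an element of `S⁰`. -/
def torsorInfty (m : ℕ) : AdjoinZero (Presented (TorsorRel m)) := incl (gen (TorsorRel m) .infty)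

theorem torsorBase_period : (m + 1) • torsorBase m = torsorBase m := by
  simpa [Multiset.map_nsmul, Multiset.sum_nsmul, torsorBase] using
    sum_incl_gen_eq (by simp) (by simp) (TorsorRel.period (m := m))

theorem torsorBase_add_torsorPoint (k : ZMod m) :
    torsorBase m + torsorPoint k = torsorPoint (k + 1) := by
  simpa [torsorBase, torsorPoint] using
    sum_incl_gen_eq (by simp) (by simp) (TorsorRel.shift k)

theorem torsorPoint_add_torsorPoint (i j : ZMod m) :
    torsorPoint i + torsorPoint j = torsorInfty m := by
  simpa [torsorInfty, torsorPoint] using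
    sum_incl_gen_eq (by simp) (by simp) (TorsorRel.collapse i j)

theorem torsorInfty_add (x : AdjoinZero (Presented (TorsorRel m))) :
    torsorInfty m + x = torsorInfty m := by
  induction x using presented_induction with
  | hzero => exact add_zero _
  | hgen y =>
    simpa [torsorInfty] using sum_incl_gen_eq (by simp) (by simp) (TorsorRel.infty y)
  | hadd x y hx hy => rw [← add_assoc, hx, hy]

theorem add_torsorInfty (x : AdjoinZero (Presented (TorsorRel m))) :
    x + torsorInfty m = torsorInfty m := by
  rw [add_comm, torsorInfty_add]

theorem nsmul_torsorBase_add_torsorPoint (j : ℕ) (k : ZMod m) :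
    j • torsorBase m + torsorPoint k = torsorPoint (k + (j : ZMod m)) := by
  induction j with
  | zero => rw [zero_nsmul, zero_add, Nat.cast_zero, add_zero]
  | succ j ih =>
    rw [succ_nsmul', add_assoc, ih, torsorBase_add_torsorPoint, Nat.cast_succ, add_assoc]

theorem nsmul_torsorBase_eq_zero : m • torsorBase m = 0 := by
  obtain h | ⟨e, he⟩ := eq_zero_or_incl (m • torsorBase m)
  · exact h
  refine he.trans ((incl_eq_zero_iff e).2 fun s => incl_injective ?_)
  rw [incl_add, ← he]
  refine presented_induction_incl (p := fun x => m • torsorBase m + x = x) (fun x => ?_)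
    (fun x y hx _ => by rw [← add_assoc, hx]) s
  cases x with
  | base => exact (succ_nsmul _ _).symm.trans torsorBase_period
  | point k =>
    refine (nsmul_torsorBase_add_torsorPoint m k).trans ?_
    rw [ZMod.natCast_self, add_zero, torsorPoint]
  | infty => exact add_torsorInfty _

theorem isAddUnit_torsorBase (hm : 0 < m) : IsAddUnit (torsorBase m) :=
  .of_nsmul_eq_zero nsmul_torsorBase_eq_zero hm.ne'

theorem torsor_cases (x : AdjoinZero (Presented (TorsorRel m))) :
    (∃ j : ℕ, x = j • torsorBase m) ∨ (∃ k, x = torsorPoint k) ∨ x = torsorInfty m := by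
  induction x using presented_induction with
  | hzero => exact .inl ⟨0, (zero_nsmul _).symm⟩
  | hgen x =>
    cases x with
    | base => exact .inl ⟨1, (one_nsmul _).symm⟩
    | point k => exact .inr (.inl ⟨k, rfl⟩)
    | infty => exact .inr (.inr rfl)
  | hadd x y hx hy =>
    obtain ⟨i, rfl⟩ | ⟨k, rfl⟩ | rfl := hx
    · obtain ⟨j, rfl⟩ | ⟨l, rfl⟩ | rfl := hy
      · exact .inl ⟨i + j, (add_nsmul _ _ _).symm⟩
      · exact .inr (.inl ⟨_, nsmul_torsorBase_add_torsorPoint _ _⟩)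
      · exact .inr (.inr (add_torsorInfty _))
    · obtain ⟨j, rfl⟩ | ⟨l, rfl⟩ | rfl := hy
      · exact .inr (.inl ⟨_, by rw [add_comm, nsmul_torsorBase_add_torsorPoint]⟩)
      · exact .inr (.inr (torsorPoint_add_torsorPoint _ _))
      · exact .inr (.inr (add_torsorInfty _))
    · exact .inr (.inr (torsorInfty_add _))

theorem finite_torsor (hm : 0 < m) : Finite (AdjoinZero (Presented (TorsorRel m))) := by
  have : NeZero m := ⟨hm.ne'⟩
  refine Finite.of_surjective (Sum.elim (fun j : Fin m => (j : ℕ) • torsorBase m)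
    (Option.elim · (torsorInfty m) torsorPoint)) fun x => ?_
  obtain ⟨j, rfl⟩ | ⟨k, rfl⟩ | rfl := torsor_cases x
  · exact ⟨.inl ⟨j % m, Nat.mod_lt _ hm⟩, (nsmul_eq_mod_nsmul j nsmul_torsorBase_eq_zero).symm⟩
  · exact ⟨.inr (some k), rfl⟩
  · exact ⟨.inr none, rfl⟩

/-- The homomorphism `torsorHom m` on generators. -/
noncomputable def torsorValue (m : ℕ) :
    TorsorGen m → Additive (DualNumber (AddMonoidAlgebra ℤ (ZMod m)))
  | .base => .ofMul (TrivSqZeroExt.inl (AddMonoidAlgebra.single 1 1))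
  | .point k => .ofMul (TrivSqZeroExt.inr (AddMonoidAlgebra.single k 1))
  | .infty => .ofMul 0

theorem sum_torsorValue_eq (u v : Multiset (TorsorGen m)) (h : TorsorRel m u v) :
    (u.map (torsorValue m)).sum = (v.map (torsorValue m)).sum := by
  rcases h with _ | k | ⟨i, j⟩ | y
  · rw [Multiset.map_nsmul, Multiset.sum_nsmul, Multiset.map_singleton, Multiset.sum_singleton,
      torsorValue, ← ofMul_pow, TrivSqZeroExt.inl_pow, AddMonoidAlgebra.single_pow, succ_nsmul,
      nsmul_one, ZMod.natCast_self, zero_add, one_pow]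
  all_goals
    simp only [Multiset.map_add, Multiset.sum_add, Multiset.map_singleton, Multiset.sum_singleton]
  · simp only [torsorValue]
    rw [← ofMul_mul, TrivSqZeroExt.inl_mul_inr, smul_eq_mul, AddMonoidAlgebra.single_mul_single,
      mul_one, add_comm]
  · simp only [torsorValue]
    rw [← ofMul_mul, TrivSqZeroExt.inr_mul_inr]
  · rw [torsorValue, ← ofMul_toMul (torsorValue m y), ← ofMul_mul, zero_mul]

/-- The homomorphism to the multiplicative monoid of the dual numbers over the group ring of `ℤ/m`
that maps `x_0` to `[1]`, `x_k` to `[k]ε` and `∞` to `0`; it separates the `x_k`, `∞` and the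
identity. -/
noncomputable def torsorHom (m : ℕ) : AdjoinZero (Presented (TorsorRel m)) →+
    Additive (DualNumber (AddMonoidAlgebra ℤ (ZMod m))) :=
  adjoinZeroLift (presentedLift (torsorValue m) sum_torsorValue_eq) fun e he => by
    have hunit : IsAddUnit (torsorValue m .base) :=
      .of_add_eq_zero (.ofMul (TrivSqZeroExt.inl (AddMonoidAlgebra.single (-1) 1))) <| by
        rw [torsorValue, ← ofMul_mul, ← TrivSqZeroExt.inl_mul, AddMonoidAlgebra.single_mul_single,
          add_neg_cancel, mul_one, ← AddMonoidAlgebra.one_def, TrivSqZeroExt.inl_one, ofMul_one]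
    have h := congrArg (presentedLift (torsorValue m) sum_torsorValue_eq) (he (gen _ .base))
    rw [map_add, presentedLift_gen] at h
    exact hunit.add_right_cancel (h.trans (zero_add _).symm)

theorem torsorHom_torsorPoint (k : ZMod m) : torsorHom m (torsorPoint k) =
    .ofMul (TrivSqZeroExt.inr (AddMonoidAlgebra.single k 1)) := by
  rw [torsorHom, torsorPoint, adjoinZeroLift_incl, presentedLift_gen, torsorValue]

theorem torsorHom_torsorInfty : torsorHom m (torsorInfty m) = .ofMul 0 := by
  rw [torsorHom, torsorInfty, adjoinZeroLift_incl, presentedLift_gen, torsorValue]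

theorem torsorPoint_injective : Function.Injective (torsorPoint (m := m)) := by
  intro i j h
  have h := congrArg (torsorHom m) h
  rw [torsorHom_torsorPoint, torsorHom_torsorPoint] at h
  exact AddMonoidAlgebra.single_left_injective one_ne_zero
    (TrivSqZeroExt.inr_injective (Additive.ofMul.injective h))

theorem torsorPoint_ne_torsorInfty (k : ZMod m) : torsorPoint k ≠ torsorInfty m := by
  intro h
  have h := congrArg (torsorHom m) h
  rw [torsorHom_torsorPoint, torsorHom_torsorInfty] at h
  simpa using congrArg TrivSqZeroExt.snd (Additive.ofMul.injective h)

theorem torsorPoint_ne_zero (k : ZMod m) : torsorPoint k ≠ 0 := by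
  intro h
  have h := congrArg (torsorHom m) h
  rw [torsorHom_torsorPoint, map_zero, ← ofMul_one] at h
  simpa using congrArg TrivSqZeroExt.fst (Additive.ofMul.injective h)

theorem torsorPoint_notMem_principalIdeal (k : ZMod m) :
    torsorPoint k ∉ principalIdeal (torsorInfty m) := by
  rintro ⟨c, hc⟩
  exact torsorPoint_ne_torsorInfty k (hc.trans (torsorInfty_add c))

theorem torsorInfty_notMem_hClass (k : ZMod m) : torsorInfty m ∉ hClass (torsorPoint k) :=
  fun h => torsorPoint_notMem_principalIdeal k (mem_hClass_iff.1 h).1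

theorem principalIdeal_torsorPoint_subset [NeZero m] (i k : ZMod m) :
    principalIdeal (torsorPoint i) ⊆ principalIdeal (torsorPoint k) := by
  have : torsorPoint i = torsorPoint k + (i - k).val • torsorBase m := by
    rw [add_comm, nsmul_torsorBase_add_torsorPoint, ZMod.natCast_zmod_val, add_sub_cancel]
  exact this ▸ principalIdeal_add_subset _ _

theorem chainLength_torsorPoint_le (hm : 0 < m) (k : ZMod m) : chainLength (torsorPoint k) ≤ 1 := by
  have : NeZero m := ⟨hm.ne'⟩
  refine chainLength_le_one fun y hy => ?_
  obtain ⟨j, rfl⟩ | ⟨i, rfl⟩ | rfl := torsor_cases y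
  · exact (isAddUnit_torsorBase hm).nsmul j
  · exact absurd (principalIdeal_torsorPoint_subset i k) hy.2
  · exact absurd (hy.1 ⟨0, (add_zero _).symm⟩) (torsorPoint_notMem_principalIdeal k)

theorem not_greenH_torsorPoint (k : ZMod m) :
    ¬ GreenH (torsorPoint k + torsorPoint k) (torsorPoint k) := by
  rw [torsorPoint_add_torsorPoint]
  exact torsorInfty_notMem_hClass k

theorem davenport_torsor (hm : 0 < m) (k : ZMod m) :
    davenport (Schutzenberger (torsorPoint k)) = m := by
  have := finite_torsor hm
  refine davenport_schutzenberger_of_generator (u := torsorBase m) (Set.toFinite _) ?_ ?_ ?_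
  · obtain ⟨v, hv⟩ := (isAddUnit_torsorBase hm).exists_neg
    refine mem_stabMonoid_of_add_mem (d := v) ?_
    rw [hv]
    exact zero_mem _
  · intro j
    rw [nsmul_torsorBase_add_torsorPoint, torsorPoint_injective.eq_iff, add_eq_left,
      ZMod.natCast_eq_zero_iff]
  · intro c hc
    have hc := hc _ (mem_hClass_self _)
    obtain ⟨j, rfl⟩ | ⟨i, rfl⟩ | rfl := torsor_cases c
    · exact ⟨j, rfl⟩
    · rw [torsorPoint_add_torsorPoint] at hc
      exact absurd hc (torsorInfty_notMem_hClass k)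
    · rw [torsorInfty_add] at hc
      exact absurd hc (torsorInfty_notMem_hClass k)

theorem torsor_sharp (hm : 0 < m) (k : ZMod m) {a : AdjoinZero (Presented (TorsorRel m))}
    (ha : a = torsorPoint k) :
    a ≠ 0 ∧ chainLength a ≠ ⊤ ∧ (hClass a).Finite ∧ ¬ GreenH (a + a) a ∧
      davenport (Schutzenberger a) = m ∧
      epsilon a * (davenport (Schutzenberger a) : ℝ≥0∞) = (relDavenport a : ℝ≥0∞) := by
  subst ha
  have := finite_torsor hm
  have hG := not_greenH_torsorPoint k
  have hle : relDavenport (torsorPoint k) + 1 ≤ davenport (Schutzenberger (torsorPoint k)) + 1 :=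
    calc _ ≤ _ := relDavenport_add_one_le (torsorPoint k)
      _ ≤ 1 + _ := by gcongr; exact chainLength_torsorPoint_le hm k
      _ = _ := add_comm _ _
  refine ⟨torsorPoint_ne_zero k, chainLength_ne_top _, Set.toFinite _, hG, davenport_torsor hm k,
    le_antisymm (epsilon_mul_davenport_le (torsorPoint_ne_zero k)) ?_⟩
  rw [epsilon, if_neg hG, one_mul, ENat.toENNReal_le]
  exact (ENat.add_le_add_iff_right ENat.one_ne_top).1 hle

end Torsor

/-! ### Artinian principal ideal rings -/

section Ring

variable {R : Type*} [CommRing R]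

theorem mul_pow_eq_left {M : Type*} [Monoid M] {x t : M} (h : x * t = x) (n : ℕ) :
    x * t ^ n = x := by
  induction n with
  | zero => rw [pow_zero, mul_one]
  | succ n ih => rw [pow_succ, ← mul_assoc, ih, h]

theorem associated_of_dvd_dvd_of_isArtinianRing [IsArtinianRing R] {x y : R} (hxy : x ∣ y)
    (hyx : y ∣ x) : Associated x y := by
  obtain ⟨c, rfl⟩ := hxy
  obtain ⟨d, hd⟩ := hyx
  obtain ⟨n, z, hz⟩ := IsArtinian.exists_pow_succ_smul_dvd c (1 : R)
  rw [smul_eq_mul, smul_eq_mul, mul_one, Nat.succ_eq_add_one, pow_succ, mul_assoc] at hz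
  -- `e` is an idempotent that fixes `x`, and `c` is invertible on the summand `e R`.
  set e : R := (c * z) ^ n with he
  have hcne : c ^ n * e = c ^ n := mul_pow_eq_left hz n
  have hee : e * e = e := by
    linear_combination z ^ n * hcne + (e - 1) * (he.trans (mul_pow c z n))
  have hcze : c * z * e = e := by
    linear_combination z ^ n * hz + (c * z - 1) * (he.trans (mul_pow c z n))
  have hxe : x * e = x := by
    have hx : x * (c * d) ^ n = x := mul_pow_eq_left (by rw [← mul_assoc]; exact hd.symm) n
    rw [mul_pow] at hx
    linear_combination (1 - e) * hx + x * d ^ n * hcne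
  refine ⟨Units.mkOfMulEqOne (c * e + (1 - e)) (z * e + (1 - e)) ?_, ?_⟩
  · linear_combination hcze + (c * z - c - z + 1) * hee
  · rw [Units.val_mkOfMulEqOne]
    linear_combination (c - 1) * hxe

open scoped Pointwise in
theorem length_quotient_smul_le (c : R) (I : Ideal R) :
    Module.length R (R ⧸ c • I) ≤ Module.length R (R ⧸ I) + Ring.ord R c := by
  have hexact : Function.Exact (Ideal.mulQuot c I).range.subtype (Ideal.quotOfMul c I) := by
    rw [LinearMap.exact_iff, Submodule.range_subtype]
    exact (Ideal.exact_mulQuot_quotOfMul I).linearMap_ker_eq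
  rw [Module.length_eq_add_of_exact _ _ (Submodule.subtype_injective _)
    (Ideal.quotOfMul_surjective I) hexact, Ring.ord]
  gcongr
  exact Module.length_le_of_surjective _ (Ideal.mulQuot c I).surjective_rangeRestrict

open scoped Pointwise in
theorem ord_mul_le (x y : R) : Ring.ord R (x * y) ≤ Ring.ord R y + Ring.ord R x := by
  have h : Ideal.span {x * y} = x • Ideal.span {y} := by
    rw [← Ideal.span_singleton_mul_span_singleton, ← smul_eq_mul,
      Submodule.ideal_span_singleton_smul]
  rw [Ring.ord, h]
  exact length_quotient_smul_le x (Ideal.span {y})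

theorem ord_prod_le {Q : Multiset R} (hQ : ∀ q ∈ Q, (Ideal.span {q}).IsMaximal) :
    Ring.ord R Q.prod ≤ Q.card := by
  induction Q using Multiset.induction with
  | empty => rw [Multiset.prod_zero, Ring.ord_one, Multiset.card_zero, Nat.cast_zero]
  | cons q Q ih =>
    rw [Multiset.forall_mem_cons] at hQ
    have hq : Ring.ord R q = 1 :=
      Module.length_eq_one_iff.2 (isSimpleModule_iff_isCoatom.2 hQ.1.out)
    rw [Multiset.prod_cons, Multiset.card_cons, Nat.cast_succ, ← hq]
    exact (ord_mul_le q Q.prod).trans (by gcongr; exact ih hQ.2)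

theorem isMaximal_colon_singleton_of_covBy {I : Ideal R} {c : R} (h : I ⋖ Ideal.span {c}) :
    (I.colon {c}).IsMaximal := by
  have := (covBy_iff_quot_is_simple h.le).1 h
  let f : R →ₗ[R] _ := (Submodule.comap (Ideal.span {c}).subtype I).mkQ ∘ₗ
    LinearMap.toSpanSingleton R _ ⟨c, Ideal.mem_span_singleton_self c⟩
  have hf : Function.Surjective f := by
    refine (Submodule.mkQ_surjective _).comp fun ⟨x, hx⟩ => ?_
    obtain ⟨y, rfl⟩ := Ideal.mem_span_singleton'.1 hx
    exact ⟨y, rfl⟩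
  have hker : f.ker = I.colon {c} := by
    ext x
    rw [LinearMap.mem_ker, Submodule.mem_colon_singleton]
    exact Submodule.Quotient.mk_eq_zero _
  rw [← hker]
  exact ⟨isSimpleModule_iff_isCoatom.1 (.congr (f.quotKerEquivOfSurjective hf))⟩

theorem colon_singleton_mul_span_singleton {I : Ideal R} {c : R} (h : I ≤ Ideal.span {c}) :
    I.colon {c} * Ideal.span {c} = I := by
  ext x
  rw [Ideal.mem_mul_span_singleton]
  constructor
  · rintro ⟨y, hy, rfl⟩
    exact Submodule.mem_colon_singleton.1 hy
  · intro hx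
    obtain ⟨y, rfl⟩ := Ideal.mem_span_singleton'.1 (h hx)
    exact ⟨y, Submodule.mem_colon_singleton.2 hx, rfl⟩

theorem exists_span_singleton_prod_eq [IsArtinianRing R] [IsPrincipalIdealRing R] (I : Ideal R) :
    ∃ Q : Multiset R, (∀ q ∈ Q, (Ideal.span {q}).IsMaximal) ∧ Ideal.span {Q.prod} = I := by
  induction I using WellFoundedGT.induction with
  | ind I ih =>
    obtain rfl | htop := eq_or_ne I ⊤
    · exact ⟨0, by simp, by rw [Multiset.prod_zero, Ideal.span_singleton_one]⟩
    obtain ⟨J, hIJ, -⟩ := exists_covBy_le_of_lt (lt_top_iff_ne_top.2 htop)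
    obtain ⟨c, rfl : J = Ideal.span {c}⟩ := IsPrincipalIdealRing.principal J
    obtain ⟨q, hq : _ = Ideal.span {q}⟩ := IsPrincipalIdealRing.principal (I.colon {c})
    obtain ⟨Q, hQ, hQc⟩ := ih _ hIJ.lt
    refine ⟨q ::ₘ Q, Multiset.forall_mem_cons.2 ⟨?_, hQ⟩, ?_⟩
    · exact hq ▸ isMaximal_colon_singleton_of_covBy hIJ
    · rw [Multiset.prod_cons, ← Ideal.span_singleton_mul_span_singleton, hQc, ← hq,
        colon_singleton_mul_span_singleton hIJ.le]

/-- The multiplicative monoid of `R`, written additively, is its own `S⁰`. -/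
def ringIncl (x : R) : AdjoinZero (Additive R) := incl (Additive.ofMul x)

theorem ringIncl_mul (x y : R) : ringIncl (x * y) = ringIncl x + ringIncl y := rfl

theorem ringIncl_one : ringIncl (1 : R) = 0 :=
  (incl_eq_zero_iff _).2 fun s => zero_add s

theorem ringIncl_injective : Function.Injective (ringIncl (R := R)) :=
  fun _ _ h => Additive.ofMul.injective (incl_injective h)

theorem ringIncl_surjective : Function.Surjective (ringIncl (R := R)) := by
  intro x
  obtain rfl | ⟨s, rfl⟩ := eq_zero_or_incl x
  · exact ⟨1, ringIncl_one⟩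
  · exact ⟨s.toMul, rfl⟩

theorem sum_map_ringIncl (Q : Multiset R) : (Q.map ringIncl).sum = ringIncl Q.prod := by
  induction Q using Multiset.induction with
  | empty => exact ringIncl_one.symm
  | cons q Q ih => rw [Multiset.map_cons, Multiset.sum_cons, ih, Multiset.prod_cons, ringIncl_mul]

theorem ringIncl_mem_principalIdeal {x y : R} :
    ringIncl x ∈ principalIdeal (ringIncl y) ↔ x ∈ Ideal.span {y} := by
  rw [Ideal.mem_span_singleton]
  constructor
  · rintro ⟨c, hc⟩
    obtain ⟨c, rfl⟩ := ringIncl_surjective c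
    exact ⟨c, ringIncl_injective hc⟩
  · rintro ⟨c, rfl⟩
    exact ⟨ringIncl c, rfl⟩

theorem principalIdeal_ringIncl_subset {x y : R} :
    principalIdeal (ringIncl x) ⊆ principalIdeal (ringIncl y) ↔
      Ideal.span {x} ≤ Ideal.span {y} := by
  simp only [Set.subset_def, SetLike.le_def, ringIncl_surjective.forall,
    ringIncl_mem_principalIdeal]

theorem ringIncl_mem_hClass {x y : R} :
    ringIncl x ∈ hClass (ringIncl y) ↔ Ideal.span {x} = Ideal.span {y} := by
  change principalIdeal (ringIncl x) = principalIdeal (ringIncl y) ↔ _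
  rw [Set.Subset.antisymm_iff, principalIdeal_ringIncl_subset, principalIdeal_ringIncl_subset,
    le_antisymm_iff]

theorem isAddUnit_ringIncl_iff {x : R} : IsAddUnit (ringIncl x) ↔ IsUnit x := by
  rw [isAddUnit_iff_exists_neg, isUnit_iff_exists_inv, ringIncl_surjective.exists]
  simp only [← ringIncl_mul, ← ringIncl_one, ringIncl_injective.eq_iff]

theorem chainLength_ringIncl_le (b : R) : chainLength (ringIncl b) ≤ Ring.ord R b := by
  refine iSup₂_le fun l ⟨f, h0, hf⟩ => ?_
  obtain ⟨g, rfl⟩ := ringIncl_surjective.comp_left f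
  let s : LTSeries (Ideal R) :=
    { length := l
      toFun := fun i => Ideal.span {g i}
      step := fun i => ⟨principalIdeal_ringIncl_subset.1 (hf i).1,
        fun h => (hf i).2 (principalIdeal_ringIncl_subset.2 h)⟩ }
  have hhead : s.head = Ideal.span {b} :=
    congrArg (fun x => Ideal.span {x}) (ringIncl_injective h0)
  rw [Ring.ord, Module.length_quotient]
  exact Order.length_le_coheight (p := s) hhead.ge

theorem exists_isAddUnit_gammaHom_eq [IsArtinianRing R] (b : R)
    (γ : Schutzenberger (ringIncl b)) :
    ∃ c : stabMonoid (ringIncl b), ↑c ∈ IsAddUnit.addSubmonoid (AdjoinZero (Additive R)) ∧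
      gammaHom (ringIncl b) c = γ := by
  obtain ⟨⟨c, hc⟩, rfl⟩ := gammaHom_surjective _ γ
  obtain ⟨c, rfl⟩ := ringIncl_surjective c
  have hspan : Ideal.span {c * b} = Ideal.span {b} :=
    ringIncl_mem_hClass.1 (hc _ (mem_hClass_self _))
  obtain ⟨u, hu⟩ := associated_of_dvd_dvd_of_isArtinianRing (dvd_mul_left b c)
    (Ideal.span_singleton_le_span_singleton.1 hspan.ge)
  have hub : ringIncl (u : R) + ringIncl b = ringIncl c + ringIncl b := by
    rw [← ringIncl_mul, mul_comm, hu, ringIncl_mul]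
  refine ⟨⟨ringIncl u, (add_mem_hClass_iff (mem_hClass_self _)).1 ?_⟩,
    isAddUnit_ringIncl_iff.2 u.isUnit, gammaHom_eq_iff.2 hub⟩
  rw [hub]
  exact hc _ (mem_hClass_self _)

theorem add_sum_map_ringIncl_ne {b : R} {P : R → Prop} {Q : Multiset R}
    (hmin : Minimal (fun U => (∀ q ∈ U, P q) ∧ Ideal.span {U.prod} = Ideal.span {b}) Q) :
    ∀ Q' < Q.map ringIncl, ∀ u ∈ IsAddUnit.addSubmonoid (AdjoinZero (Additive R)),
      u + Q'.sum ≠ ringIncl b := by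
  intro Q' hQ' u hu h
  obtain ⟨U, hU, rfl⟩ := exists_map_eq_of_lt_map hQ'
  obtain ⟨u, rfl⟩ := ringIncl_surjective u
  rw [sum_map_ringIncl, ← ringIncl_mul] at h
  have hUb : Ideal.span {U.prod} = Ideal.span {b} := by
    rw [← ringIncl_injective h, Ideal.span_singleton_mul_left_unit (isAddUnit_ringIncl_iff.1 hu)]
  exact hmin.not_prop_of_lt hU ⟨fun q hq => hmin.prop.1 q (Multiset.mem_of_le hU.le hq), hUb⟩

theorem ring_sharp [IsArtinianRing R] [IsPrincipalIdealRing R] {b : R} (hb : ¬ IsUnit b)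
    {a : AdjoinZero (Additive R)} (ha : a = ringIncl b) :
    a ≠ 0 ∧ chainLength a ≠ ⊤ ∧
      relDavenport a + 1 = chainLength a + davenport (Schutzenberger a) := by
  subst ha
  obtain ⟨Q, hmin⟩ :=
    exists_minimal_of_wellFoundedLT _ (exists_span_singleton_prod_eq (Ideal.span {b}))
  obtain ⟨hQ, hQb⟩ := hmin.prop
  have hΨ : chainLength (ringIncl b) ≤ Q.card :=
    calc chainLength (ringIncl b) ≤ Ring.ord R b := chainLength_ringIncl_le b
      _ = Ring.ord R Q.prod := by rw [Ring.ord, Ring.ord, hQb]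
      _ ≤ Q.card := ord_prod_le hQ
  have hQ0 : Q ≠ 0 := by
    rintro rfl
    rw [Multiset.prod_zero, Ideal.span_singleton_one] at hQb
    exact hb (Ideal.span_singleton_eq_top.1 hQb.symm)
  refine ⟨?_, ne_top_of_le_ne_top (ENat.natCast_ne_top _) hΨ,
    (relDavenport_add_one_le _).antisymm ?_⟩
  · rw [← ringIncl_one, ringIncl_injective.ne_iff]
    rintro rfl
    exact hb isUnit_one
  calc chainLength (ringIncl b) + davenport (Schutzenberger (ringIncl b))
      ≤ (Q.map ringIncl).card + davenport (Schutzenberger (ringIncl b)) := by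
        rw [Multiset.card_map]
        gcongr
    _ ≤ relDavenport (ringIncl b) + 1 :=
      card_add_davenport_le (exists_isAddUnit_gammaHom_eq b) (by simpa using hQ0)
        (by rw [sum_map_ringIncl, ringIncl_mem_hClass, hQb]) (add_sum_map_ringIncl_ne hmin)

end Ring

end RelDavenport

theorem theorem1p2_general :
    (∀ (S : Type*) [AddCommSemigroup S] (a : AdjoinZero S), a ≠ 0 →
      ((hClass a).Infinite → relDavenport a = ⊤) ∧
      ((hClass a).Finite → chainLength a ≠ ⊤ → relDavenport a ≠ ⊤) ∧
      epsilon a * (davenport (Schutzenberger a) : ℝ≥0∞) ≤ (relDavenport a : ℝ≥0∞) ∧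
      relDavenport a + 1 ≤ chainLength a + davenport (Schutzenberger a)) ∧
    (∀ (h r : ℕ) (k : Fin r) (a : AdjoinZero (Presented (ChainRel (2 * h) r))),
      0 < h → a = h • incl (gen (ChainRel (2 * h) r) k) →
        a ≠ 0 ∧ chainLength a ≠ ⊤ ∧ (hClass a).Finite ∧ GreenH (a + a) a ∧
        davenport (Schutzenberger a) = (2 * h : ℕ) ∧
        epsilon a * (davenport (Schutzenberger a) : ℝ≥0∞) = (relDavenport a : ℝ≥0∞)) ∧
    (∀ (m : ℕ) (k : ZMod m) (a : AdjoinZero (Presented (TorsorRel m))),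
      0 < m → a = incl (gen (TorsorRel m) (.point k)) →
        a ≠ 0 ∧ chainLength a ≠ ⊤ ∧ (hClass a).Finite ∧ ¬ GreenH (a + a) a ∧
        davenport (Schutzenberger a) = m ∧
        epsilon a * (davenport (Schutzenberger a) : ℝ≥0∞) = (relDavenport a : ℝ≥0∞)) ∧
    (∀ (R : Type*) [CommRing R] [IsArtinianRing R] [IsPrincipalIdealRing R] (b : R)
      (a : AdjoinZero (Additive R)), ¬ IsUnit b → a = incl (Additive.ofMul b) →
        a ≠ 0 ∧ chainLength a ≠ ⊤ ∧
        relDavenport a + 1 = chainLength a + davenport (Schutzenberger a)) :=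
  ⟨fun _ _ a h0 => ⟨relDavenport_eq_top h0, relDavenport_ne_top, epsilon_mul_davenport_le h0,
      relDavenport_add_one_le a⟩,
    fun _ _ k _ hh ha => chain_sharp k hh ha,
    fun _ k _ hm ha => torsor_sharp hm k ha,
    fun _ _ _ _ _ _ hb ha => ring_sharp hb ha⟩

theorem theorem1p2 :
    -- the bounds
    (∀ (S : Type*) [AddCommSemigroup S] (a : AdjoinZero S), a ≠ 0 → chainLength a ≠ ⊤ →
      ((hClass a).Infinite → relDavenport a = ⊤) ∧
      ((hClass a).Finite →
        relDavenport a ≠ ⊤ ∧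
        epsilon a * (davenport (Schutzenberger a) : ℝ≥0∞) ≤ (relDavenport a : ℝ≥0∞) ∧
        relDavenport a + 1 ≤ chainLength a + davenport (Schutzenberger a))) ∧
    -- sharpness of the lower bound when `a + a` and `a` are related, for `n = 2 * h`
    (∀ (h r : ℕ) (k : Fin r) (a : AdjoinZero (Presented (ChainRel (2 * h) r))),
      0 < h → a = h • incl (gen (ChainRel (2 * h) r) k) →
        a ≠ 0 ∧ chainLength a ≠ ⊤ ∧ (hClass a).Finite ∧ GreenH (a + a) a ∧
        davenport (Schutzenberger a) = (2 * h : ℕ) ∧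
        epsilon a * (davenport (Schutzenberger a) : ℝ≥0∞) = (relDavenport a : ℝ≥0∞)) ∧
    -- sharpness of the lower bound when `a + a` and `a` are not related
    (∀ (m : ℕ) (a : AdjoinZero (Presented (TorsorRel m))),
      2 < m → a = incl (gen (TorsorRel m) (.point (m : ZMod m))) →
        a ≠ 0 ∧ chainLength a ≠ ⊤ ∧ (hClass a).Finite ∧ ¬ GreenH (a + a) a ∧
        davenport (Schutzenberger a) = m ∧
        epsilon a * (davenport (Schutzenberger a) : ℝ≥0∞) = (relDavenport a : ℝ≥0∞)) ∧
    -- sharpness of the upper bound: multiplicative semigroups of finite principal ideal rings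
    (∀ (R : Type*) [CommRing R] [Finite R] [IsPrincipalIdealRing R] (b : R)
      (a : AdjoinZero (Additive R)), ¬ IsUnit b → a = incl (Additive.ofMul b) →
        a ≠ 0 ∧ chainLength a ≠ ⊤ ∧ (hClass a).Finite ∧
        relDavenport a + 1 = chainLength a + davenport (Schutzenberger a)) := by
  obtain ⟨bounds, chain, torsor, ring⟩ := theorem1p2_general
  refine ⟨fun S _ a h0 hΨ => ?_, chain, fun m a hm => torsor m m a (by lia),
    fun R _ _ _ b a hb ha => ?_⟩
  · obtain ⟨hinf, hfin, hlower, hupper⟩ := bounds S a h0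
    exact ⟨hinf, fun h => ⟨hfin h hΨ, hlower, hupper⟩⟩
  · obtain ⟨h0, hΨ, heq⟩ := ring R b a hb ha
    have : Finite (AdjoinZero (Additive R)) := .of_surjective _ ringIncl_surjective
    exact ⟨h0, hΨ, Set.toFinite _, heq⟩
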